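/- Let $\Phi$ be a root system of type $H_4$ in a Euclidean space $V$ of dimension 4 with inner product $(\cdot\mid\cdot)$: $\Phi$ is a finite set of nonzero vectors such that $\Phi\cap\mathbb R\alpha=\{\alpha,-\alpha\}$ and $s_\alpha\Phi=\Phi$ for every $\alpha\in\Phi$, where $s_\alpha$ is the orthogonal reflection in the hyperplane $\alpha^\perp$. Let $\alpha_1,\alpha_2,\alpha_3,\alpha_4\in\Phi$ be simple roots (a basis of $V$ in which the coordinates of every root are all $\ge 0$ or all $\le 0$), numbered so that the Coxeter graph is $1\overset{5}{-}2-3-4$; that is, the angle between $\alpha_i$ and $\alpha_j$ ($i\neq j$) is $\pi-\pi/m_{ij}$ with $m_{12}=5$, $m_{23}=m_{34}=3$, $m_{13}=m_{14}=m_{24}=2$. Let $\Phi^+$ be the set of roots with nonnegative coordinates, ordered by $\beta\le\gamma$ if $\gamma-\beta=\sum_i c_i\alpha_i$ with all real $c_i\ge 0$. Let $\mathcal I$ be the set of increasing subsets of $\Phi^+$ (subsets $I$ such that $\beta\in I$, $\gamma \in \Phi^+$, $\beta\le\gamma$ imply $\gamma\in I$), and for an antichain $\Lambda\subseteq\Phi^+$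 put $I(\Lambda)=\{\beta\in\Phi^+\mid \delta\le\beta\text{ for some }\delta\in\Lambda\}$. Let $\mathcal R$ be the set of dominant regions, i.e. of the connected components $R$ of $$V\setminus\bigcup_{\beta\in\Phi^+,\ c\in\{-1,0,1\}}\{v\in V\mid (v\mid\beta)=c\}$$ that are contained in $C=\{v\in V\mid (v\mid\alpha_i)>0\text{ for } 1\le i\le 4\}$, and for $R\in\mathcal R$ let $I_R=\{\beta\in\Phi^+\mid (v\mid\beta)>1\text{ for all }v\in R\}$. With $\tau=\frac{1+\sqrt5}{2}$ and $(c_1,c_2,c_3,c_4)$ standing for $\sum_i c_i\alpha_i$, put $$\begin{aligned} \alpha_{13}&=(\tau,\tau,\tau,0), & \alpha_{14}&=(1,\tau,\tau,\tau), & \alpha_{16}&=(\tau,1,1,1),\\ \alpha_{17}&=(\tau,\tau+1,\tau,0), & \alpha_{18}&=(\tau,\tau,\tau,\tau), & \alpha_{19}&=(\tau+1,\tau+1,1,0),\\ \alpha_{20}&=(\tau,\tau+1,1,1), & \alpha_{21}&=(\tau+1,\tau+1,\tau,0), & \alpha_{22}&=(\tau,\tau+1,\tau,\tau),\\ \alpha_{23}&=(\tau+1,\tau+1,1,1),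 & \alpha_{25}&=(\tau+1,2\tau,\tau,0), & \alpha_{28}&=(\tau+1,\tau+1,\tau+1,1) \end{aligned}$$ and $$\begin{aligned} \Lambda_1&=\{\alpha_{16}\}, & \Lambda_2&=\{\alpha_{13},\alpha_{16}\}, & \Lambda_3&=\{\alpha_{13},\alpha_{20}\}, & \Lambda_4&=\{\alpha_{14},\alpha_{19}\},\\ \Lambda_5&=\{\alpha_{14},\alpha_{21}\}, & \Lambda_6&=\{\alpha_{14},\alpha_{25}\}, & \Lambda_7&=\{\alpha_{16},\alpha_{17}\}, & \Lambda_8&=\{\alpha_{16},\alpha_{21}\},\\ \Lambda_9&=\{\alpha_{16},\alpha_{25}\}, & \Lambda_{10}&=\{\alpha_{18},\alpha_{21}\}, & \Lambda_{11}&=\{\alpha_{18},\alpha_{25}\}, & \Lambda_{12}&=\{\alpha_{21},\alpha_{22}\},\\ \Lambda_{13}&=\{\alpha_{14},\alpha_{21},\alpha_{23}\}, & \Lambda_{14}&=\{\alpha_{14},\alpha_{23},\alpha_{25}\}, & \Lambda_{15}&=\{\alpha_{14},\alpha_{25},\alpha_{28}\}, & \Lambda_{16}&=\{\alpha_{18},\alpha_{25},\alpha_{28}\}.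 \end{aligned}$$ Then $\Phi^+$ has exactly 60 elements and exactly 429 antichains (the empty one included), and $\Lambda_1,\dots,\Lambda_{16}$ are pairwise distinct antichains in $\Phi^+$. The assignment $R\mapsto I_R$ is an injective map from $\mathcal R$ to $\mathcal I$; it is not surjective, and its image is exactly $\mathcal I\setminus\{I(\Lambda_i)\mid 1\le i\le 16\}$. In particular, there are exactly 413 dominant regions. -/

import Mathlib

noncomputable section

namespace RootRegions

variable {V : Type*} [NormedAddCommGroup V] [InnerProductSpace ℝ V] {ι : Type*}

/-- A (reduced, not necessarily crystallographic) root system in a Euclidean space: a finite set of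
nonzero vectors such that the only multiples of a root `α` that are roots are `α` and `-α`, and such
that the set is stable under the orthogonal reflection in the hyperplane orthogonal to any root. -/
structure IsRootSystem (Φ : Set V) : Prop where
  finite : Φ.Finite
  zero_notMem : (0 : V) ∉ Φ
  inter_span : ∀ α ∈ Φ, Φ ∩ (Submodule.span ℝ {α} : Submodule ℝ V) = {α, -α}
  reflection_image : ∀ α ∈ Φ, (Submodule.span ℝ {α})ᗮ.reflection '' Φ = Φ

/-- The basis `Δ` of `V` is a system of simple roots for `Φ`: it consists of roots, and the
coordinates of every root with respect to `Δ` are all nonnegative or all nonpositive. -/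
structure IsSimpleSystem (Φ : Set V) (Δ : Module.Basis ι ℝ V) : Prop where
  mem : ∀ i, Δ i ∈ Φ
  sameSign : ∀ β ∈ Φ, (∀ i, 0 ≤ Δ.repr β i) ∨ (∀ i, Δ.repr β i ≤ 0)

/-- The simple roots `Δ 0, Δ 1, Δ 2, Δ 3` have Coxeter graph `o -5- o --- o --- o` in this order:
`Δ i` and `Δ j` span the angle `π - π / m i j`, with `m` the Coxeter matrix of type `H₄`. (Mathlib's
`CoxeterMatrix.H₄` has the bond labelled `5` at the last two nodes, so the order is reversed.) -/
def IsTypeH4 (Δ : Module.Basis (Fin 4) ℝ V) : Prop :=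
  ∀ i j : Fin 4, inner ℝ (Δ i) (Δ j) =
    -(‖Δ i‖ * ‖Δ j‖ * Real.cos (Real.pi / (CoxeterMatrix.H₄ (Fin.rev i) (Fin.rev j) : ℝ)))

/-- The set `Φ⁺` of positive roots. -/
def posRoots (Φ : Set V) (Δ : Module.Basis ι ℝ V) : Set V :=
  {β ∈ Φ | ∀ i, 0 ≤ Δ.repr β i}

/-- The root order: `β ≤ γ` if `γ - β` is a linear combination of simple roots with nonnegative
real coefficients. -/
def rootLE (Δ : Module.Basis ι ℝ V) (β γ : V) : Prop :=
  ∀ i, 0 ≤ Δ.repr (γ - β) i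

/-- The (affine) hyperplane `H_{β,c}`. -/
def hyperplane (β : V) (c : ℝ) : Set V := {v | inner ℝ v β = c}

/-- The open half space `H_{β,1}⁺`. -/
def positiveSide (β : V) : Set V := {v | 1 < inner ℝ v β}

/-- The complement of the union of the hyperplanes `H_{β,c}`, for `β` a positive root and
`c = -1, 0, 1`. -/
def arrangementComplement (Φ : Set V) (Δ : Module.Basis ι ℝ V) : Set V :=
  (⋃ β ∈ posRoots Φ Δ, ⋃ c ∈ ({-1, 0, 1} : Set ℝ), hyperplane β c)ᶜ

/-- The dominant chamber `C`. -/
def dominantChamber (Δ : Module.Basis ι ℝ V) : Set V :=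
  {v | ∀ i, 0 < inner ℝ v (Δ i)}

/-- The set of dominant regions: the connected components of the complement of the arrangement
that lie in the dominant chamber. -/
def dominantRegions (Φ : Set V) (Δ : Module.Basis ι ℝ V) : Set (Set V) :=
  {R | (∃ v ∈ arrangementComplement Φ Δ,
      R = connectedComponentIn (arrangementComplement Φ Δ) v) ∧ R ⊆ dominantChamber Δ}

/-- The set `I_R` of the positive roots `β` with `R ⊆ H_{β,1}⁺`. -/
def regionRoots (Φ : Set V) (Δ : Module.Basis ι ℝ V) (R : Set V) : Set V :=
  {β ∈ posRoots Φ Δ | R ⊆ positiveSide β}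

/-- The set of all increasing subsets of the positive root poset. -/
def increasingSets (Φ : Set V) (Δ : Module.Basis ι ℝ V) : Set (Set V) :=
  {I | I ⊆ posRoots Φ Δ ∧
    ∀ β ∈ posRoots Φ Δ, ∀ γ ∈ posRoots Φ Δ, rootLE Δ β γ → β ∈ I → γ ∈ I}

/-- The set of all antichains of the positive root poset. -/
def antichains (Φ : Set V) (Δ : Module.Basis ι ℝ V) : Set (Set V) :=
  {Λ | Λ ⊆ posRoots Φ Δ ∧ IsAntichain (rootLE Δ) Λ}

/-- The increasing set `I(Λ)` generated by `Λ`. -/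
def generatedSet (Φ : Set V) (Δ : Module.Basis ι ℝ V) (Λ : Set V) : Set V :=
  {β ∈ posRoots Φ Δ | ∃ δ ∈ Λ, rootLE Δ δ β}

/-- Coordinates, with respect to the simple roots, of the positive roots of type `H₄` that occur in
the sixteen exceptional antichains. The positive roots are numbered from `1` to `60`; the numbers
that are not needed get the junk value `0`. -/
def h4Coords : ℕ → Fin 4 → ℝ
  | 13 => ![τ, τ, τ, 0]
  | 14 => ![1, τ, τ, τ]
  | 16 => ![τ, 1, 1, 1]
  | 17 => ![τ, τ + 1, τ, 0]
  | 18 => ![τ, τ, τ, τ]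
  | 19 => ![τ + 1, τ + 1, 1, 0]
  | 20 => ![τ, τ + 1, 1, 1]
  | 21 => ![τ + 1, τ + 1, τ, 0]
  | 22 => ![τ, τ + 1, τ, τ]
  | 23 => ![τ + 1, τ + 1, 1, 1]
  | 25 => ![τ + 1, 2 * τ, τ, 0]
  | 28 => ![τ + 1, τ + 1, τ + 1, 1]
  | _ => 0
where
  /-- The golden ratio. -/
  τ : ℝ := Real.goldenRatio

/-- The `k`-th positive root of type `H₄`, for the numbers `k` covered by `h4Coords`. -/
def h4Root (Δ : Module.Basis (Fin 4) ℝ V) (k : ℕ) : V := ∑ i, h4Coords k i • Δ i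

/-- The numbers of the roots in the sixteen exceptional antichains. -/
def exceptionalIndices : Fin 16 → Set ℕ :=
  ![{16}, {13, 16}, {13, 20}, {14, 19},
    {14, 21}, {14, 25}, {16, 17}, {16, 21},
    {16, 25}, {18, 21}, {18, 25}, {21, 22},
    {14, 21, 23}, {14, 23, 25}, {14, 25, 28}, {18, 25, 28}]

/-- The sixteen exceptional antichains. -/
def exceptionalAntichain (Δ : Module.Basis (Fin 4) ℝ V) (i : Fin 16) : Set V :=
  h4Root Δ '' exceptionalIndices i

end RootRegions

end

noncomputable section

namespace RootRegions

/-! ### Dominant regions as sign cells in the chamber. -/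

section Regions

variable {V : Type*} [NormedAddCommGroup V] [InnerProductSpace ℝ V] {ι : Type*}
  {Φ : Set V} {Δ : Module.Basis ι ℝ V}

/-! Every positive root is positive on the dominant chamber, so only the hyperplanes `(v|β) = 1` cut
it, and the dominant regions are the nonempty convex cells on which no `(v|β) - 1` changes sign
(`connectedComponentIn_arrangementComplement`). A region is therefore determined by the set of roots
that exceed 1 on it, and this set is increasing. What remains is to decide for which increasing sets
the resulting system of strict inequalities has a solution in the chamber.

This is a finite problem once the roots are known. The bonds 3 and 5 are odd, which forces the
simple roots to have equal length, so the simple reflections are determined in coordinates. A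
descent on the coordinate sum then shows that the positive roots are the 60 entries of `rootTable`
(`posRoots_eq`). Their coordinates lie in `ℕ[τ]`, where inequalities reduce to inequalities between
natural numbers.

An explicit point realises each non-exceptional increasing set (`filter_upMasks`). The sixteen
others are excluded by Farkas certificates (`setOf_one_lt_inner_ne`): a positive combination of
roots that should exceed 1 is bounded by a combination, of no larger total weight, of roots that
should not. For `Λ₁` the certificate is `(1 + τ) α₁₆ ≤ τ α₁₄ + α₂₅`. Antichains correspond to
increasing sets through minimal elements, so their number is `413 + 16 = 429`. -/

theorem inner_eq_sum_repr [Fintype ι] (Δ : Module.Basis ι ℝ V) (v β : V) :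
    inner ℝ v β = ∑ i, Δ.repr β i * inner ℝ v (Δ i) := by
  conv_lhs => rw [← Δ.sum_repr β]
  rw [inner_sum]
  exact Finset.sum_congr rfl fun i _ => inner_smul_right _ _ _

theorem inner_pos_of_mem_dominantChamber [Fintype ι] (h0 : (0 : V) ∉ Φ) {v β : V}
    (hv : v ∈ dominantChamber Δ) (hβ : β ∈ posRoots Φ Δ) : 0 < inner ℝ v β := by
  rw [inner_eq_sum_repr Δ]
  have hne : Δ.repr β ≠ 0 := by
    intro h
    rw [LinearEquiv.map_eq_zero_iff] at h
    exact h0 (h ▸ hβ.1)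
  obtain ⟨i, hi⟩ := Finsupp.ne_iff.1 hne
  exact Finset.sum_pos' (fun j _ => mul_nonneg (hβ.2 j) (hv j).le)
    ⟨i, Finset.mem_univ _, mul_pos (lt_of_le_of_ne (hβ.2 i) (Ne.symm hi)) (hv i)⟩

theorem mem_arrangementComplement {v : V} :
    v ∈ arrangementComplement Φ Δ ↔
      ∀ β ∈ posRoots Φ Δ, inner ℝ v β ≠ -1 ∧ inner ℝ v β ≠ 0 ∧ inner ℝ v β ≠ 1 := by
  simp [arrangementComplement, hyperplane]

theorem mem_arrangementComplement_of_mem_dominantChamber [Fintype ι] (h0 : (0 : V) ∉ Φ) {v : V}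
    (hv : v ∈ dominantChamber Δ) :
    v ∈ arrangementComplement Φ Δ ↔ ∀ β ∈ posRoots Φ Δ, inner ℝ v β ≠ 1 := by
  rw [mem_arrangementComplement]
  refine forall₂_congr fun β hβ => ?_
  have := inner_pos_of_mem_dominantChamber h0 hv hβ
  exact ⟨fun h => h.2.2, fun h => ⟨by linarith, this.ne', h⟩⟩

theorem lt_inner_of_isPreconnected {S : Set V} (hS : IsPreconnected S) {β : V} {c : ℝ}
    (hc : ∀ w ∈ S, inner ℝ w β ≠ c) {v w : V} (hv : v ∈ S) (hw : w ∈ S)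
    (h : c < inner ℝ v β) : c < inner ℝ w β := by
  by_contra hle
  obtain ⟨u, hu, huc⟩ := hS.intermediate_value hw hv
    (f := fun w => inner ℝ w β) (by fun_prop) ⟨not_lt.1 hle, h.le⟩
  exact hc u hu huc

/-- By the intermediate value theorem no form changes sides of a removed value on a connected set;
this gives one inclusion. Conversely the cell is convex, hence connected, and it avoids all
hyperplanes because those with `c = 0, -1` miss the chamber. -/
theorem connectedComponentIn_arrangementComplement [Fintype ι] (h0 : (0 : V) ∉ Φ)
    (hΔ : ∀ i, Δ i ∈ Φ) {v : V} (hv : v ∈ dominantChamber Δ)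
    (hvA : v ∈ arrangementComplement Φ Δ) :
    connectedComponentIn (arrangementComplement Φ Δ) v =
      {w ∈ dominantChamber Δ | ∀ β ∈ posRoots Φ Δ,
        inner ℝ w β ≠ 1 ∧ (1 < inner ℝ w β ↔ 1 < inner ℝ v β)} := by
  have hpre := isPreconnected_connectedComponentIn (x := v) (F := arrangementComplement Φ Δ)
  have hsub := connectedComponentIn_subset (arrangementComplement Φ Δ) v
  have hmem := mem_connectedComponentIn hvA
  have hsimple : ∀ i, Δ i ∈ posRoots Φ Δ := fun i =>
    ⟨hΔ i, fun j => by
      classical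
      rw [Δ.repr_self, Finsupp.single_apply]
      split_ifs <;> norm_num⟩
  apply Set.Subset.antisymm
  · intro w hw
    have hA := fun u (hu : u ∈ connectedComponentIn _ _) =>
      mem_arrangementComplement.1 (hsub hu)
    refine ⟨fun i => lt_inner_of_isPreconnected hpre (fun u hu => (hA u hu _ (hsimple i)).2.1)
      hmem hw (hv i), fun β hβ => ⟨(hA w hw β hβ).2.2, fun h => ?_, fun h => ?_⟩⟩
    · exact lt_inner_of_isPreconnected hpre (fun u hu => (hA u hu _ hβ).2.2) hw hmem h
    · exact lt_inner_of_isPreconnected hpre (fun u hu => (hA u hu _ hβ).2.2) hmem hw h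
  · have hv1 := (mem_arrangementComplement_of_mem_dominantChamber h0 hv).1 hvA
    refine IsPreconnected.subset_connectedComponentIn ?_ ⟨hv, fun β hβ => ⟨hv1 β hβ, Iff.rfl⟩⟩ ?_
    · apply Convex.isPreconnected
      rintro x ⟨hx, hx'⟩ y ⟨hy, hy'⟩ a b ha hb hab
      have hcomb : ∀ {β : V} {c : ℝ}, c < inner ℝ x β → c < inner ℝ y β →
          c < inner ℝ (a • x + b • y) β := by
        intro β c h1 h2
        rw [inner_add_left, real_inner_smul_left, real_inner_smul_left]
        obtain rfl : b = 1 - a := by linarith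
        rcases ha.eq_or_lt with rfl | ha
        · simpa using h2
        · nlinarith
      have hcomb' : ∀ {β : V} {c : ℝ}, inner ℝ x β < c → inner ℝ y β < c →
          inner ℝ (a • x + b • y) β < c := by
        intro β c h1 h2
        rw [inner_add_left, real_inner_smul_left, real_inner_smul_left]
        obtain rfl : b = 1 - a := by linarith
        rcases ha.eq_or_lt with rfl | ha
        · simpa using h2
        · nlinarith
      refine ⟨fun i => hcomb (hx i) (hy i), fun β hβ => ?_⟩
      by_cases h : 1 < inner ℝ v β
      · have := hcomb ((hx' β hβ).2.2 h) ((hy' β hβ).2.2 h)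
        exact ⟨this.ne', iff_of_true this h⟩
      · have := hcomb'
          (lt_of_le_of_ne (not_lt.1 (mt (hx' β hβ).2.1 h)) (hx' β hβ).1)
          (lt_of_le_of_ne (not_lt.1 (mt (hy' β hβ).2.1 h)) (hy' β hβ).1)
        exact ⟨this.ne, iff_of_false this.not_gt h⟩
    · rintro w ⟨hw, hw'⟩
      exact (mem_arrangementComplement_of_mem_dominantChamber h0 hw).2 fun β hβ => (hw' β hβ).1

/-- The dominant regions are the sign cells of the points of the chamber off the hyperplanes. -/
theorem mem_dominantRegions_iff [Fintype ι] (h0 : (0 : V) ∉ Φ) (hΔ : ∀ i, Δ i ∈ Φ) {R : Set V} :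
    R ∈ dominantRegions Φ Δ ↔ ∃ v ∈ dominantChamber Δ, (∀ β ∈ posRoots Φ Δ, inner ℝ v β ≠ 1) ∧
      R = {w ∈ dominantChamber Δ | ∀ β ∈ posRoots Φ Δ,
        inner ℝ w β ≠ 1 ∧ (1 < inner ℝ w β ↔ 1 < inner ℝ v β)} := by
  constructor
  · rintro ⟨⟨v, hvA, rfl⟩, hR⟩
    have hv := hR (mem_connectedComponentIn hvA)
    exact ⟨v, hv, (mem_arrangementComplement_of_mem_dominantChamber h0 hv).1 hvA,
      connectedComponentIn_arrangementComplement h0 hΔ hv hvA⟩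
  · rintro ⟨v, hv, hv1, rfl⟩
    have hvA := (mem_arrangementComplement_of_mem_dominantChamber h0 hv).2 hv1
    exact ⟨⟨v, hvA, (connectedComponentIn_arrangementComplement h0 hΔ hv hvA).symm⟩,
      fun w hw => hw.1⟩

theorem regionRoots_cell {v : V} (hv : v ∈ dominantChamber Δ)
    (hv1 : ∀ β ∈ posRoots Φ Δ, inner ℝ v β ≠ 1) :
    regionRoots Φ Δ {w ∈ dominantChamber Δ | ∀ β ∈ posRoots Φ Δ,
        inner ℝ w β ≠ 1 ∧ (1 < inner ℝ w β ↔ 1 < inner ℝ v β)} =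
      {β ∈ posRoots Φ Δ | 1 < inner ℝ v β} := by
  ext β
  refine and_congr_right fun hβ => ⟨fun h => ?_, fun h w hw => ((hw.2 β hβ).2.2 h :)⟩
  exact h (show v ∈ _ from ⟨hv, fun γ hγ => ⟨hv1 γ hγ, Iff.rfl⟩⟩)

/-- This removes topology from the problem: only points of the chamber off the hyperplanes matter
from here on. -/
theorem image_regionRoots [Fintype ι] (h0 : (0 : V) ∉ Φ) (hΔ : ∀ i, Δ i ∈ Φ) :
    regionRoots Φ Δ '' dominantRegions Φ Δ =
      {I | ∃ v ∈ dominantChamber Δ, (∀ β ∈ posRoots Φ Δ, inner ℝ v β ≠ 1) ∧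
        I = {β ∈ posRoots Φ Δ | 1 < inner ℝ v β}} := by
  ext I
  constructor
  · rintro ⟨R, hR, rfl⟩
    obtain ⟨v, hv, hv1, rfl⟩ := (mem_dominantRegions_iff h0 hΔ).1 hR
    exact ⟨v, hv, hv1, regionRoots_cell hv hv1⟩
  · rintro ⟨v, hv, hv1, rfl⟩
    exact ⟨_, (mem_dominantRegions_iff h0 hΔ).2 ⟨v, hv, hv1, rfl⟩, regionRoots_cell hv hv1⟩

theorem injOn_regionRoots [Fintype ι] (h0 : (0 : V) ∉ Φ) (hΔ : ∀ i, Δ i ∈ Φ) :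
    Set.InjOn (regionRoots Φ Δ) (dominantRegions Φ Δ) := by
  intro R hR S hS h
  obtain ⟨v, hv, hv1, rfl⟩ := (mem_dominantRegions_iff h0 hΔ).1 hR
  obtain ⟨w, hw, hw1, rfl⟩ := (mem_dominantRegions_iff h0 hΔ).1 hS
  rw [regionRoots_cell hv hv1, regionRoots_cell hw hw1] at h
  have key : ∀ β ∈ posRoots Φ Δ, (1 < inner ℝ v β ↔ 1 < inner ℝ w β) := fun β hβ => by
    have := Set.ext_iff.1 h β
    simpa [hβ] using this
  ext u
  exact and_congr_right fun _ => forall₂_congr fun β hβ => by rw [key β hβ]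

theorem inner_le_of_rootLE [Fintype ι] {v β γ : V} (hv : v ∈ dominantChamber Δ)
    (h : rootLE Δ β γ) : inner ℝ v β ≤ inner ℝ v γ := by
  have : 0 ≤ inner ℝ v (γ - β) := by
    rw [inner_eq_sum_repr Δ]
    exact Finset.sum_nonneg fun i _ => mul_nonneg (h i) (hv i).le
  rw [inner_sub_right] at this
  linarith

theorem mapsTo_regionRoots [Fintype ι] (h0 : (0 : V) ∉ Φ) (hΔ : ∀ i, Δ i ∈ Φ) :
    Set.MapsTo (regionRoots Φ Δ) (dominantRegions Φ Δ) (increasingSets Φ Δ) := by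
  intro R hR
  obtain ⟨v, hv, hv1, rfl⟩ := (mem_dominantRegions_iff h0 hΔ).1 hR
  rw [regionRoots_cell hv hv1]
  exact ⟨fun β hβ => hβ.1, fun β _ _ hγ hle hβI =>
    ⟨hγ, hβI.2.trans_le (inner_le_of_rootLE hv hle)⟩⟩

/-- The values of `inner v (Δ i)` can be prescribed. -/
theorem exists_inner_eq [Fintype ι] (Δ : Module.Basis ι ℝ V) (x : ι → ℝ) :
    ∃ v : V, ∀ i, inner ℝ v (Δ i) = x i := by
  have : FiniteDimensional ℝ V := Δ.finiteDimensional_of_finite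
  let f : V →ₗ[ℝ] ι → ℝ := LinearMap.pi fun i => (innerₗ V).flip (Δ i)
  have hf : Function.Injective f := by
    rw [← LinearMap.ker_eq_bot, LinearMap.ker_eq_bot']
    intro v hv
    refine InnerProductSpace.ext_inner_right_basis Δ fun i => ?_
    simpa [f, real_inner_comm] using congrFun hv i
  have hd : Module.finrank ℝ V = Module.finrank ℝ (ι → ℝ) := by
    rw [Module.finrank_eq_card_basis Δ, Module.finrank_fintype_fun_eq_card]
  obtain ⟨v, hv⟩ := (LinearMap.injective_iff_surjective_of_finrank_eq_finrank hd).1 hf x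
  exact ⟨v, fun i => by simpa [f, real_inner_comm] using congrFun hv i⟩

end Regions

/-! ### Antichains and increasing sets. -/

section Antichains

variable {V : Type*} [NormedAddCommGroup V] [InnerProductSpace ℝ V] {ι : Type*}
  {Φ : Set V} {Δ : Module.Basis ι ℝ V}

theorem rootLE_refl (β : V) : rootLE Δ β β := fun i => by simp

theorem rootLE_trans {β γ δ : V} (h : rootLE Δ β γ) (h' : rootLE Δ γ δ) : rootLE Δ β δ := by
  intro i
  have := add_nonneg (h i) (h' i)
  rwa [← Finsupp.add_apply, ← map_add, add_comm, sub_add_sub_cancel] at this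

theorem rootLE_antisymm {β γ : V} (h : rootLE Δ β γ) (h' : rootLE Δ γ β) : β = γ := by
  apply Δ.ext_elem
  intro i
  have h1 := h i
  have h2 := h' i
  simp only [map_sub, Finsupp.sub_apply] at h1 h2
  linarith

theorem generatedSet_mem_increasingSets (Λ : Set V) :
    generatedSet Φ Δ Λ ∈ increasingSets Φ Δ :=
  ⟨fun _ h => h.1, fun _ _ _ hγ hle h =>
    ⟨hγ, h.2.imp fun _ hδ => ⟨hδ.1, rootLE_trans hδ.2 hle⟩⟩⟩

/-- If both antichains generate the same set, then `β ∈ Λ` lies above some `γ ∈ Λ'`, which lies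
above some `δ ∈ Λ`; the antichain property forces `δ = β`, hence `γ = β`. -/
theorem injOn_generatedSet : Set.InjOn (generatedSet Φ Δ) (antichains Φ Δ) := by
  have key : ∀ Λ ∈ antichains Φ Δ, ∀ Λ' ∈ antichains Φ Δ,
      generatedSet Φ Δ Λ = generatedSet Φ Δ Λ' → Λ ⊆ Λ' := by
    intro Λ hΛ Λ' hΛ' h β hβ
    have h1 : β ∈ generatedSet Φ Δ Λ' := h ▸ ⟨hΛ.1 hβ, β, hβ, rootLE_refl β⟩
    obtain ⟨_, γ, hγ, hle⟩ := h1
    have h2 : γ ∈ generatedSet Φ Δ Λ := h ▸ ⟨hΛ'.1 hγ, γ, hγ, rootLE_refl γ⟩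
    obtain ⟨_, δ, hδ, hle'⟩ := h2
    obtain rfl := hΛ.2.eq hδ hβ (rootLE_trans hle' hle)
    rwa [rootLE_antisymm hle' hle]
  exact fun Λ hΛ Λ' hΛ' h => (key Λ hΛ Λ' hΛ' h).antisymm (key Λ' hΛ' Λ hΛ h.symm)

/-- A finite increasing set is generated by its minimal elements. -/
theorem image_generatedSet (hΦ : Φ.Finite) :
    generatedSet Φ Δ '' antichains Φ Δ = increasingSets Φ Δ := by
  apply Set.Subset.antisymm
  · rintro _ ⟨Λ, -, rfl⟩
    exact generatedSet_mem_increasingSets Λ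
  · rintro I ⟨hI, hI'⟩
    let _ : PartialOrder V :=
      { le := rootLE Δ
        le_refl := rootLE_refl
        le_trans := fun _ _ _ => rootLE_trans
        le_antisymm := fun _ _ => rootLE_antisymm }
    have hfin : I.Finite := hΦ.subset fun β hβ => (hI hβ).1
    refine ⟨{β | Minimal (· ∈ I) β}, ⟨fun β hβ => hI hβ.1, setOfPred_minimal_antichain _⟩, ?_⟩
    ext β
    constructor
    · rintro ⟨hβ, δ, hδ, hle⟩
      exact hI' δ (hI hδ.1) β hβ hle hδ.1
    · intro hβ
      obtain ⟨δ, hle, hδ⟩ := hfin.exists_le_minimal hβ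
      exact ⟨hI hβ, δ, hδ, hle⟩

theorem ncard_antichains (hΦ : Φ.Finite) :
    (antichains Φ Δ).ncard = (increasingSets Φ Δ).ncard := by
  rw [← image_generatedSet hΦ, injOn_generatedSet.ncard_image]

end Antichains

/-! ### Exact arithmetic and order in `ℕ[τ]`. -/

/-- The semiring `ℕ[τ]` of natural combinations of `1` and `τ`, with `τ² = 1 + τ`. -/
abbrev GoldenNat : Type := QuadraticAlgebra ℕ 1 1

namespace GoldenNat

/-- The embedding of `ℕ[τ]` into `ℝ`. -/
def toReal : GoldenNat →+* ℝ where
  toFun z := z.re + z.im * Real.goldenRatio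
  map_zero' := by simp
  map_one' := by
    rw [show (1 : GoldenNat).re = 1 from rfl, show (1 : GoldenNat).im = 0 from rfl]
    simp
  map_add' z w := by simp; ring
  map_mul' z w := by
    simp only [QuadraticAlgebra.re_mul, QuadraticAlgebra.im_mul]
    push_cast
    linear_combination (-(z.im * w.im : ℝ)) * Real.goldenRatio_sq

theorem toReal_apply (z : GoldenNat) : toReal z = z.re + z.im * Real.goldenRatio := rfl

theorem toReal_nonneg (z : GoldenNat) : 0 ≤ toReal z := by
  have := Real.goldenRatio_pos
  rw [toReal_apply]
  positivity

theorem eq_of_mul_goldenRatio_eq {a b c d : ℚ}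
    (h : (a + b * Real.goldenRatio : ℝ) = c + d * Real.goldenRatio) : a = c ∧ b = d := by
  have hbd : b = d := by
    by_contra hne
    refine (Real.goldenRatio_irrational.ratCast_mul (sub_ne_zero.2 hne)).ne_rat (c - a) ?_
    push_cast
    linear_combination h
  subst hbd
  exact ⟨by exact_mod_cast add_right_cancel h, rfl⟩

theorem toReal_injective : Function.Injective toReal := by
  intro z w h
  obtain ⟨h1, h2⟩ := eq_of_mul_goldenRatio_eq (a := z.re) (b := z.im) (c := w.re) (d := w.im)
    (by simpa [toReal_apply] using h)
  ext
  · exact_mod_cast h1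
  · exact_mod_cast h2

/-- The test for `z ≤ w` in `ℝ`; it compares `n` with `m * τ` through the sign of the norm
`n² - m * n - m²`. -/
protected def le (z w : GoldenNat) : Bool :=
  bif Nat.ble z.im w.im then
    Nat.ble ((z.re - w.re) * (z.re - w.re)) ((w.im - z.im) * (w.im - z.im + (z.re - w.re)))
  else
    Nat.ble ((z.im - w.im) * (z.im - w.im + (w.re - z.re))) ((w.re - z.re) * (w.re - z.re))

/-- The norm factors as `m² + mn - n² = (mτ - n)(n + m(τ - 1))`, and the second factor is
nonnegative, so the sign of the norm is that of `mτ - n`. -/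
theorem le_mul_goldenRatio_iff (n m : ℕ) :
    (n : ℝ) ≤ m * Real.goldenRatio ↔ n * n ≤ m * (m + n) := by
  have h1 := Real.goldenRatio_sq
  have h2 := Real.one_lt_goldenRatio
  rify
  have hn : (0 : ℝ) ≤ n := n.cast_nonneg
  have hm : (0 : ℝ) ≤ m := m.cast_nonneg
  have key : (m * (m + n) - n * n : ℝ) =
      (m * Real.goldenRatio - n) * (n + m * (Real.goldenRatio - 1)) := by
    linear_combination (-(m : ℝ) ^ 2) * h1
  have hpos : (0 : ℝ) ≤ n + m * (Real.goldenRatio - 1) := by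
    have := mul_nonneg hm (sub_nonneg.2 h2.le)
    linarith
  constructor
  · intro h
    have := mul_nonneg (sub_nonneg.2 h) hpos
    linarith
  · intro h
    by_contra! hlt
    have hn' : (0 : ℝ) < n := lt_of_le_of_lt (by positivity) hlt
    have hpos' : (0 : ℝ) < n + m * (Real.goldenRatio - 1) := by
      have := mul_nonneg hm (sub_nonneg.2 h2.le)
      linarith
    have := mul_pos (sub_pos.2 hlt) hpos'
    linarith

theorem mul_goldenRatio_le_iff (n m : ℕ) (hm : m ≠ 0) :
    m * Real.goldenRatio ≤ (n : ℝ) ↔ m * (m + n) ≤ n * n := by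
  have hne : (n : ℝ) ≠ m * Real.goldenRatio := by
    intro h
    refine (Real.goldenRatio_irrational.natCast_mul hm).ne_nat n h.symm
  have hne' : n * n ≠ m * (m + n) := by
    intro h
    have h1 := (le_mul_goldenRatio_iff n m).2 h.le
    have h2 := Real.goldenRatio_sq
    have h3 := Real.one_lt_goldenRatio
    rify at h
    have hm' : (0 : ℝ) < m := by exact_mod_cast Nat.pos_of_ne_zero hm
    have : (m * Real.goldenRatio - n) * (n + m * (Real.goldenRatio - 1)) = 0 := by
      linear_combination (m : ℝ) ^ 2 * h2 - h
    rcases mul_eq_zero.1 this with h4 | h4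
    · exact hne (by linarith)
    · have := mul_pos hm' (sub_pos.2 h3)
      have : (0 : ℝ) ≤ n := n.cast_nonneg
      linarith
  have := le_mul_goldenRatio_iff n m
  constructor
  · intro h
    by_contra! hlt
    exact hne (le_antisymm (this.2 hlt.le) h)
  · intro h
    by_contra! hlt
    exact hne' (le_antisymm (this.1 hlt.le) h)

/-- In each branch one difference is a true difference and the other is truncated. A truncation to
`0` occurs only when the signs already settle the comparison, and the test then gives the right
answer: true in the first branch, false in the second. -/
theorem le_iff (z w : GoldenNat) : z.le w = true ↔ toReal z ≤ toReal w := by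
  have hφ := Real.goldenRatio_pos
  obtain ⟨a, b⟩ := z
  obtain ⟨c, d⟩ := w
  simp only [GoldenNat.le, toReal_apply, cond_eq_ite, Nat.ble_eq]
  split_ifs with h
  · rw [Nat.ble_eq, ← le_mul_goldenRatio_iff]
    obtain ⟨e, rfl⟩ := Nat.exists_eq_add_of_le h
    rcases le_total c a with hca | hca
    · obtain ⟨f, rfl⟩ := Nat.exists_eq_add_of_le hca
      simp only [Nat.add_sub_cancel_left]
      push_cast
      constructor <;> intro _ <;> linarith
    · rw [Nat.sub_eq_zero_of_le hca]
      have : (a : ℝ) ≤ c := by exact_mod_cast hca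
      have h1 : (0 : ℝ) ≤ e * Real.goldenRatio := by positivity
      simp only [Nat.add_sub_cancel_left]
      push_cast
      exact iff_of_true h1 (by linarith)
  · have hlt := not_le.1 h
    rw [Nat.ble_eq, ← mul_goldenRatio_le_iff _ _ (by omega)]
    obtain ⟨e, rfl⟩ := Nat.exists_eq_add_of_lt hlt
    rw [show d + e + 1 - d = e + 1 by omega]
    rcases le_total a c with hca | hca
    · obtain ⟨f, rfl⟩ := Nat.exists_eq_add_of_le hca
      simp only [Nat.add_sub_cancel_left]
      push_cast
      constructor <;> intro _ <;> linarith
    · rw [Nat.sub_eq_zero_of_le hca]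
      have : (c : ℝ) ≤ a := by exact_mod_cast hca
      have h1 : (0 : ℝ) < (e + 1) * Real.goldenRatio := by positivity
      push_cast
      exact iff_of_false (by linarith) (by linarith)

end GoldenNat

/-! ### Enumeration of increasing sets as bitmasks. -/

section Bitmask

variable {α : Type*}

/-- The bitmask of the sublist of the elements that satisfy `p`, the first element of the list
being the least significant. -/
def bitmask (p : α → Bool) (l : List α) : ℕ :=
  l.foldr (fun a m => Nat.bit (p a) m) 0

@[simp]
theorem bitmask_nil (p : α → Bool) : bitmask p [] = 0 := rfl

@[simp]
theorem bitmask_cons (p : α → Bool) (a : α) (l : List α) :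
    bitmask p (a :: l) = Nat.bit (p a) (bitmask p l) := rfl

theorem bit_eq_bit_iff {b c : Bool} {m n : ℕ} : Nat.bit b m = Nat.bit c n ↔ b = c ∧ m = n := by
  cases b <;> cases c <;> simp [Nat.bit_val] <;> omega

theorem bitmask_eq_iff {p q : α → Bool} {l : List α} :
    bitmask p l = bitmask q l ↔ ∀ a ∈ l, p a = q a := by
  induction l with
  | nil => simp
  | cons a l ih => simp [bit_eq_bit_iff, ih]

theorem bitmask_land (p q : α → Bool) (l : List α) :
    bitmask p l &&& bitmask q l = bitmask (fun a => p a && q a) l := by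
  induction l with
  | nil => simp
  | cons a l ih => simp [Nat.land_bit, ih]

/-- The list of the bitmasks of the increasing subsets of a list, with respect to `le`. -/
def upMasks (le : α → α → Bool) : List α → List ℕ
  | [] => [0]
  | a :: l => (upMasks le l).flatMap fun m =>
      bif Nat.beq (bitmask (le a) l &&& m) (bitmask (le a) l) then
        [Nat.bit false m, Nat.bit true m]
      else [Nat.bit false m]

theorem nodup_upMasks (le : α → α → Bool) (l : List α) : (upMasks le l).Nodup := by
  induction l with
  | nil => simp [upMasks]
  | cons a l ih =>
    rw [upMasks, List.nodup_flatMap]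
    constructor
    · intro m _
      cases Nat.beq (bitmask (le a) l &&& m) (bitmask (le a) l) <;> simp
    · refine ih.imp fun {m n} hmn => ?_
      rw [Function.onFun, List.disjoint_left]
      intro k hk hk'
      apply hmn
      -- Deleting the lowest bit recovers the mask of the tail, so different tails yield disjoint
      -- lists.
      have key : ∀ (c : Bool) (m : ℕ),
          k ∈ (bif c then [Nat.bit false m, Nat.bit true m] else [Nat.bit false m]) →
            k.div2 = m := by
        intro c m h
        cases c <;> simp at h <;> grind [Nat.div2_bit]
      rw [← key _ m hk, ← key _ n hk']

/-- A head `a` may join an increasing subset of the tail exactly when all tail elements above `a`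
are present, which is the test in `upMasks`. Only this containment is needed: a surplus of masks
would do no harm, since `filter_upMasks` realises every non-exceptional one. -/
theorem bitmask_mem_upMasks {le : α → α → Bool} {p : α → Bool} {l : List α}
    (h : l.Pairwise fun a b => le a b = true → p a = true → p b = true) :
    bitmask p l ∈ upMasks le l := by
  induction l with
  | nil => simp [upMasks]
  | cons a l ih =>
    rw [List.pairwise_cons] at h
    rw [upMasks, List.mem_flatMap]
    refine ⟨bitmask p l, ih h.2, ?_⟩
    rw [bitmask_cons]
    cases hp : p a with
    | false => cases Nat.beq _ _ <;> simp
    | true =>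
      have : bitmask (le a) l &&& bitmask p l = bitmask (le a) l := by
        rw [bitmask_land, bitmask_eq_iff]
        intro b hb
        have := h.1 b hb
        cases hab : le a b <;> simp_all
      simp [this]

end Bitmask

/-! ### Tables of roots, sample points and certificates, with their finite verifications. -/

/-- Coordinates with respect to the four simple roots. -/
abbrev GoldenVec : Type := Fin 4 → GoldenNat

/-- The coordinates of the positive roots of type `H₄`, by increasing depth. -/
def rootTable : List GoldenVec := [
  ![⟨1, 0⟩, ⟨0, 0⟩, ⟨0, 0⟩, ⟨0, 0⟩], ![⟨0, 0⟩, ⟨1, 0⟩, ⟨0, 0⟩, ⟨0, 0⟩],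
  ![⟨0, 0⟩, ⟨0, 0⟩, ⟨1, 0⟩, ⟨0, 0⟩], ![⟨0, 0⟩, ⟨0, 0⟩, ⟨0, 0⟩, ⟨1, 0⟩],
  ![⟨0, 0⟩, ⟨1, 0⟩, ⟨1, 0⟩, ⟨0, 0⟩], ![⟨0, 0⟩, ⟨0, 0⟩, ⟨1, 0⟩, ⟨1, 0⟩],
  ![⟨1, 0⟩, ⟨0, 1⟩, ⟨0, 0⟩, ⟨0, 0⟩], ![⟨0, 1⟩, ⟨1, 0⟩, ⟨0, 0⟩, ⟨0, 0⟩],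
  ![⟨0, 0⟩, ⟨1, 0⟩, ⟨1, 0⟩, ⟨1, 0⟩], ![⟨0, 1⟩, ⟨0, 1⟩, ⟨0, 0⟩, ⟨0, 0⟩],
  ![⟨0, 1⟩, ⟨1, 0⟩, ⟨1, 0⟩, ⟨0, 0⟩], ![⟨1, 0⟩, ⟨0, 1⟩, ⟨0, 1⟩, ⟨0, 0⟩],
  ![⟨0, 1⟩, ⟨0, 1⟩, ⟨0, 1⟩, ⟨0, 0⟩], ![⟨1, 0⟩, ⟨0, 1⟩, ⟨0, 1⟩, ⟨0, 1⟩],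
  ![⟨0, 1⟩, ⟨1, 1⟩, ⟨1, 0⟩, ⟨0, 0⟩], ![⟨0, 1⟩, ⟨1, 0⟩, ⟨1, 0⟩, ⟨1, 0⟩],
  ![⟨0, 1⟩, ⟨1, 1⟩, ⟨0, 1⟩, ⟨0, 0⟩], ![⟨0, 1⟩, ⟨0, 1⟩, ⟨0, 1⟩, ⟨0, 1⟩],
  ![⟨1, 1⟩, ⟨1, 1⟩, ⟨1, 0⟩, ⟨0, 0⟩], ![⟨0, 1⟩, ⟨1, 1⟩, ⟨1, 0⟩, ⟨1, 0⟩],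
  ![⟨1, 1⟩, ⟨1, 1⟩, ⟨0, 1⟩, ⟨0, 0⟩], ![⟨0, 1⟩, ⟨1, 1⟩, ⟨0, 1⟩, ⟨0, 1⟩],
  ![⟨1, 1⟩, ⟨1, 1⟩, ⟨1, 0⟩, ⟨1, 0⟩], ![⟨0, 1⟩, ⟨1, 1⟩, ⟨1, 1⟩, ⟨1, 0⟩],
  ![⟨1, 1⟩, ⟨0, 2⟩, ⟨0, 1⟩, ⟨0, 0⟩], ![⟨1, 1⟩, ⟨1, 1⟩, ⟨0, 1⟩, ⟨0, 1⟩],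
  ![⟨0, 1⟩, ⟨1, 1⟩, ⟨1, 1⟩, ⟨0, 1⟩], ![⟨1, 1⟩, ⟨1, 1⟩, ⟨1, 1⟩, ⟨1, 0⟩],
  ![⟨1, 1⟩, ⟨0, 2⟩, ⟨0, 1⟩, ⟨0, 1⟩], ![⟨1, 1⟩, ⟨1, 1⟩, ⟨1, 1⟩, ⟨0, 1⟩],
  ![⟨1, 1⟩, ⟨1, 2⟩, ⟨1, 1⟩, ⟨1, 0⟩], ![⟨1, 1⟩, ⟨0, 2⟩, ⟨0, 2⟩, ⟨0, 1⟩],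
  ![⟨1, 1⟩, ⟨1, 2⟩, ⟨1, 1⟩, ⟨0, 1⟩], ![⟨1, 2⟩, ⟨1, 2⟩, ⟨1, 1⟩, ⟨1, 0⟩],
  ![⟨1, 1⟩, ⟨1, 2⟩, ⟨0, 2⟩, ⟨0, 1⟩], ![⟨1, 2⟩, ⟨1, 2⟩, ⟨1, 1⟩, ⟨0, 1⟩],
  ![⟨1, 2⟩, ⟨2, 2⟩, ⟨1, 1⟩, ⟨1, 0⟩], ![⟨1, 2⟩, ⟨1, 2⟩, ⟨0, 2⟩, ⟨0, 1⟩],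
  ![⟨1, 2⟩, ⟨2, 2⟩, ⟨1, 1⟩, ⟨0, 1⟩], ![⟨1, 2⟩, ⟨2, 2⟩, ⟨2, 1⟩, ⟨1, 0⟩],
  ![⟨1, 2⟩, ⟨1, 3⟩, ⟨0, 2⟩, ⟨0, 1⟩], ![⟨1, 2⟩, ⟨2, 2⟩, ⟨1, 2⟩, ⟨0, 1⟩],
  ![⟨1, 2⟩, ⟨2, 2⟩, ⟨2, 1⟩, ⟨1, 1⟩], ![⟨2, 2⟩, ⟨1, 3⟩, ⟨0, 2⟩, ⟨0, 1⟩],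
  ![⟨1, 2⟩, ⟨1, 3⟩, ⟨1, 2⟩, ⟨0, 1⟩], ![⟨1, 2⟩, ⟨2, 2⟩, ⟨1, 2⟩, ⟨1, 1⟩],
  ![⟨2, 2⟩, ⟨1, 3⟩, ⟨1, 2⟩, ⟨0, 1⟩], ![⟨1, 2⟩, ⟨1, 3⟩, ⟨1, 2⟩, ⟨1, 1⟩],
  ![⟨2, 2⟩, ⟨2, 3⟩, ⟨1, 2⟩, ⟨0, 1⟩], ![⟨2, 2⟩, ⟨1, 3⟩, ⟨1, 2⟩, ⟨1, 1⟩],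
  ![⟨1, 3⟩, ⟨2, 3⟩, ⟨1, 2⟩, ⟨0, 1⟩], ![⟨2, 2⟩, ⟨2, 3⟩, ⟨1, 2⟩, ⟨1, 1⟩],
  ![⟨1, 3⟩, ⟨2, 3⟩, ⟨1, 2⟩, ⟨1, 1⟩], ![⟨2, 2⟩, ⟨2, 3⟩, ⟨2, 2⟩, ⟨1, 1⟩],
  ![⟨1, 3⟩, ⟨2, 3⟩, ⟨2, 2⟩, ⟨1, 1⟩], ![⟨1, 3⟩, ⟨3, 3⟩, ⟨2, 2⟩, ⟨1, 1⟩],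
  ![⟨2, 3⟩, ⟨3, 3⟩, ⟨2, 2⟩, ⟨1, 1⟩], ![⟨2, 3⟩, ⟨2, 4⟩, ⟨2, 2⟩, ⟨1, 1⟩],
  ![⟨2, 3⟩, ⟨2, 4⟩, ⟨1, 3⟩, ⟨1, 1⟩], ![⟨2, 3⟩, ⟨2, 4⟩, ⟨1, 3⟩, ⟨0, 2⟩]]

/-- The `k`-th positive root, counted from `1`. -/
def tableRoot (k : ℕ) : GoldenVec := rootTable.getD (k - 1) 0

/-- The coordinatewise order. -/
def GoldenVec.le (r s : GoldenVec) : Bool :=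
  (r 0).le (s 0) && (r 1).le (s 1) && (r 2).le (s 2) && (r 3).le (s 3)

/-- The sum of the coordinates at the neighbours of a node in the Coxeter graph, weighted by
`2 cos (π / m)`. -/
def neighborSum (r : GoldenVec) : GoldenVec :=
  ![⟨0, 1⟩ * r 1, ⟨0, 1⟩ * r 0 + r 2, r 1 + r 3, r 2]

/-- The test for `s` to be the image of `r` under the `i`-th simple reflection. -/
def isReflection (i : Fin 4) (r s : GoldenVec) : Bool :=
  decide (r i + s i = neighborSum r i) && decide (∀ j, j = i ∨ r j = s j)

/-- The coordinates of the `i`-th simple root. -/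
def simpleVec (i : Fin 4) : GoldenVec := Pi.single i 1

theorem simpleVec_mem_rootTable : ∀ i, simpleVec i ∈ rootTable := by
  decide +kernel

/-- A simple reflection permutes the positive roots other than its own simple root. This closure
property drives both inclusions of `posRoots_eq`. -/
theorem rootTable_reflection :
    ∀ r ∈ rootTable, ∀ i, r = simpleVec i ∨ ∃ s ∈ rootTable, isReflection i r s = true := by
  decide +kernel

/-- The table is a linear extension of the root order. As `le` is reflexive, this also rules out
repetitions. -/
theorem rootTable_pairwise : rootTable.Pairwise fun r s => s.le r = false := by
  decide +kernel

theorem rootTable_ne_zero : ∀ r ∈ rootTable, r ≠ 0 := by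
  decide +kernel

/-- Points of the dominant regions: a point is coded by its four coordinates, as digits in base
`100`, in the unit `2 / 123`. -/
def samplePoints : List ℕ := [
  1010101, 9030101, 2070101, 4020401, 5040202, 5040301, 4040203, 3010404, 1010306, 5070101,
  5060103, 2050204, 8040301, 11040102, 11040201, 11060101, 16030101, 4040303, 1050501, 7030303,
  7040401, 7060202, 12040202, 3050402, 1070204, 2030306, 6030501, 8070201, 12040301, 1060501,
  5010603, 2060501, 4010801, 1030801, 6070301, 10070102, 5030305, 9010404, 4080301, 4110101,
  7070301, 7100101, 2140101, 4030602, 3020801, 2060403, 1040603, 6020701, 7020701, 5080302,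
  4120201, 11070301, 15090101, 16090101, 17090101, 13040501, 16060301, 18070201, 18090101,
  20020402, 20050301, 20080101, 24030301, 25060101, 28010401, 27050101, 29040101, 27020401,
  29010302, 30030201, 31040101, 33030101, 34010103, 36010101, 4090401, 5140101, 4150101, 3160101,
  8070501, 5040801, 9070501, 8110301, 7140201, 15050303, 14070401, 12130101, 17040501, 20060301,
  25020501, 22070201, 24080101, 26020402, 27020204, 27060201, 28040301, 29050201, 31040103,
  34050101, 4070701, 3110501, 3150301, 9050602, 6070306, 8090501, 5140301, 16040601, 21040501,
  24010601, 19070401, 21080301, 24030501, 26010502, 24070301, 26060301, 29050301, 31030203,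
  34030301, 2100602, 4140302, 12030901, 6060901, 13090402, 20030701, 17090203, 20110201, 22010801,
  22020405, 22070401, 25060302, 28050401, 30040104, 35040301, 6080702, 6051301, 1051601, 10110304,
  15120301, 4140206, 10150203, 6180202, 11050903, 3051601, 18050307, 5011802, 15100601, 5031701,
  21080303, 25050501, 27050205, 31060301, 6031701, 7011801, 5090805, 1081303, 10070310, 12030414,
  3061008, 1110314, 8021010, 4060515, 1040517, 10110702, 6130901, 2071501, 1111301, 15110206,
  20070504, 25070106, 31070104, 13070313, 18050609, 24040409, 30030308, 9150306, 14130602,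
  14180106, 17180202, 12080313, 18051203, 19090310, 22140406, 19021501, 21021303, 32080604,
  44040406, 51030803, 53100404, 66050505, 5061304, 2110314, 7031701, 8040910, 4080415, 5070318,
  10030911, 16020615, 9050516, 14030418, 9040517, 14020419, 4101104, 1170409, 5131201, 10180704,
  9210801, 3190804, 1211001, 6240306, 6270304, 3270405, 1300108, 4280601, 1320205, 1370101,
  8090611, 6110413, 1100515, 11061205, 13110906, 15160903, 13051601, 16051206, 17071402, 37061403,
  44071402, 55111202, 63071402, 9141104, 7161302, 10140510, 14220406, 6190905, 2260409, 9240704,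
  8300306, 9350304, 3100911, 1171106, 6150414, 9170413, 3200709, 1220215, 6200610, 3250509,
  1330407, 8091602, 8131501, 12091305, 18170607, 26190408, 41160806, 48190408, 64190408, 9141303,
  14240802, 14300306, 15330402, 26240703, 33240802, 42240802, 63240802, 19300306, 29300405,
  34300306, 62300306, 20350203, 24340401, 30350202, 63350202, 6041606, 3121603, 2062002, 14070419,
  15070912, 15040126, 25070714, 49071011, 54120514, 65070714, 8140615, 6160320, 7171007, 10240411,
  6330506, 5081214, 1071220, 1011920, 9091705, 4081813, 5012316, 4112504, 2032910, 3033703,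
  11080424, 8130224, 24171007, 39171007, 48171007, 64171007, 16240312, 33250509, 42240312,
  63240312, 14330506, 27310804, 33330506, 63330506, 12030725, 6070527, 7011425, 1110230, 1061128,
  2020436, 27081706, 40091705, 53131703, 66091705, 11101019, 44101019, 53130719, 65101019,
  10011920, 42011920, 59031920, 63011920, 4140328, 44140427, 52140328, 63140328, 4061227, 9030436,
  44061227, 56061227, 62061227, 51020933, 56060436, 65030436, 15142008, 30142106, 41290906,
  68142106, 11042613, 15043505, 33042613, 56062811, 64042613, 22043604, 54083703, 65043604,
  8260818, 17291710, 6432206, 37321114, 72321114, 19481908, 12741212, 70481908, 74741212, 4112019,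
  4143210, 6100636, 12121544, 13131374, 11312019, 4442019, 31312019, 65112019, 10532019, 4652019,
  65442019, 65652019, 14153408, 6303606, 51153408, 67153408, 36303606, 6683606, 68303606, 68683606,
  10401231, 3491529, 24410636, 68100636, 10531231, 6680636, 65531231, 68680636, 28132826, 28132874,
  13284417, 13284474, 18188018, 18188080, 44271544, 44281374, 78172140, 80181880, 39393939,
  39393980, 39398018, 39398080, 25873131, 28902890, 28909028, 28909090, 80393923, 80393980,
  90289028, 90289090, 87873131, 90902890, 90909028, 90909090]

/-- The digit of index `i` in base `100`. -/
def digit (n i : ℕ) : ℕ := n / 100 ^ i % 100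

/-- The value of the linear form `r` at the point coded by `n`, in the unit `2 / 123`. -/
def sampleValue (n : ℕ) (r : GoldenVec) : GoldenNat :=
  ⟨digit n 0 * (r 0).re + digit n 1 * (r 1).re + digit n 2 * (r 2).re + digit n 3 * (r 3).re,
   digit n 0 * (r 0).im + digit n 1 * (r 1).im + digit n 2 * (r 2).im + digit n 3 * (r 3).im⟩

/-- The test for `r` to be larger than `1` at the point coded by `n`. -/
def sampleTest (n : ℕ) (r : GoldenVec) : Bool :=
  !GoldenNat.le ⟨2 * (sampleValue n r).re, 2 * (sampleValue n r).im⟩ ⟨123, 0⟩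

/-- The exceptional antichains, as lists. -/
def exceptionalList : Fin 16 → List ℕ :=
  ![[16], [13, 16], [13, 20], [14, 19],
    [14, 21], [14, 25], [16, 17], [16, 21],
    [16, 25], [18, 21], [18, 25], [21, 22],
    [14, 21, 23], [14, 23, 25], [14, 25, 28], [18, 25, 28]]

/-- The test for `r` to lie above one of the roots with numbers in `l`. -/
def generatedTest (l : List ℕ) (r : GoldenVec) : Bool := l.any fun k => (tableRoot k).le r

/-- The bitmasks of the increasing sets generated by the exceptional antichains. -/
def exceptionalMasks : List ℕ :=
  (List.ofFn exceptionalList).map fun l => bitmask (generatedTest l) rootTable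

theorem samplePoints_pos : ∀ n ∈ samplePoints, ∀ i : Fin 4, 0 < digit n i := by
  decide +kernel

theorem nodup_exceptionalMasks : exceptionalMasks.Nodup := by
  decide +kernel

/-- All increasing sets but the exceptional ones come from a sample point. -/
theorem filter_upMasks :
    (upMasks GoldenVec.le rootTable).filter (fun m => !exceptionalMasks.contains m) =
      samplePoints.map fun n => bitmask (sampleTest n) rootTable := by
  decide +kernel

theorem length_samplePoints : samplePoints.length = 413 := by
  decide +kernel

/-- Two weighted sums of roots for each exceptional antichain: the first one of roots in the
increasing set it generates, the second one, which is not smaller, of roots outside of it. -/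
def certificate : Fin 16 → List (GoldenNat × ℕ) × List (GoldenNat × ℕ) :=
  ![([(⟨1, 1⟩, 16)], [(⟨0, 1⟩, 14), (⟨1, 0⟩, 25)]),
    ([(⟨1, 0⟩, 13), (⟨1, 1⟩, 16)], [(⟨0, 1⟩, 14), (⟨0, 1⟩, 19)]),
    ([(⟨1, 0⟩, 13), (⟨0, 1⟩, 20)], [(⟨1, 0⟩, 14), (⟨0, 1⟩, 19)]),
    ([(⟨0, 1⟩, 14), (⟨1, 0⟩, 19)], [(⟨1, 1⟩, 24)]),
    ([(⟨2, 1⟩, 14), (⟨0, 2⟩, 21)], [(⟨1, 1⟩, 23), (⟨0, 2⟩, 24)]),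
    ([(⟨2, 0⟩, 14), (⟨0, 1⟩, 25)], [(⟨0, 2⟩, 28)]),
    ([(⟨1, 1⟩, 16), (⟨1, 0⟩, 17)], [(⟨0, 1⟩, 14), (⟨0, 1⟩, 19)]),
    ([(⟨1, 1⟩, 16)], [(⟨0, 1⟩, 14), (⟨1, 0⟩, 19)]),
    ([(⟨0, 1⟩, 16), (⟨1, 1⟩, 25)], [(⟨1, 0⟩, 14), (⟨0, 2⟩, 21)]),
    ([(⟨2, 1⟩, 18), (⟨1, 1⟩, 21)], [(⟨0, 2⟩, 23), (⟨1, 1⟩, 24)]),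
    ([(⟨2, 0⟩, 18), (⟨0, 1⟩, 25)], [(⟨0, 2⟩, 28)]),
    ([(⟨0, 1⟩, 21), (⟨1, 0⟩, 22)], [(⟨0, 1⟩, 23), (⟨1, 0⟩, 24)]),
    ([(⟨0, 1⟩, 14), (⟨1, 0⟩, 21)], [(⟨1, 1⟩, 24)]),
    ([(⟨0, 1⟩, 14), (⟨1, 0⟩, 25)], [(⟨1, 1⟩, 24)]),
    ([(⟨2, 0⟩, 14), (⟨0, 1⟩, 25)], [(⟨0, 1⟩, 23), (⟨0, 1⟩, 24)]),
    ([(⟨2, 1⟩, 18), (⟨1, 1⟩, 25)], [(⟨0, 2⟩, 23), (⟨1, 1⟩, 24)])]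

/-- The weighted sum of roots described by `l`. -/
def combination (l : List (GoldenNat × ℕ)) : GoldenVec :=
  fun i => (l.map fun p => p.1 * tableRoot p.2 i).sum

/-- The sum of the weights in `l`. -/
def totalWeight (l : List (GoldenNat × ℕ)) : GoldenNat := (l.map Prod.fst).sum

theorem certificate_fst : ∀ i, (certificate i).1 ≠ [] ∧
    ∀ p ∈ (certificate i).1, p.1 ≠ 0 ∧ tableRoot p.2 ∈ rootTable ∧
      generatedTest (exceptionalList i) (tableRoot p.2) = true := by
  decide +kernel

theorem certificate_snd : ∀ i, ∀ p ∈ (certificate i).2, tableRoot p.2 ∈ rootTable ∧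
      generatedTest (exceptionalList i) (tableRoot p.2) = false := by
  decide +kernel

theorem certificate_le : ∀ i,
    GoldenVec.le (combination (certificate i).1) (combination (certificate i).2) = true ∧
      GoldenNat.le (totalWeight (certificate i).2) (totalWeight (certificate i).1) = true := by
  decide +kernel

theorem exceptionalList_antichain : ∀ i, ∀ k ∈ exceptionalList i, tableRoot k ∈ rootTable ∧
    ∀ l ∈ exceptionalList i, (tableRoot k).le (tableRoot l) = true → k = l := by
  decide +kernel

/-! ### Determination of the positive roots of type `H₄`. -/

section RootSystems

variable {V : Type*} [NormedAddCommGroup V] [InnerProductSpace ℝ V] {Φ : Set V}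

theorem IsRootSystem.reflection_mem (hΦ : IsRootSystem Φ) {α β : V} (hα : α ∈ Φ) (hβ : β ∈ Φ) :
    β - (2 * (inner ℝ α β / ‖α‖ ^ 2)) • α ∈ Φ := by
  rw [← hΦ.reflection_image α hα]
  refine ⟨β, hβ, ?_⟩
  rw [Submodule.reflection_orthogonal_apply, Submodule.reflection_singleton_apply, mul_smul,
    two_smul, two_smul]
  simp

theorem IsRootSystem.smul_mem_iff (hΦ : IsRootSystem Φ) {α : V} (hα : α ∈ Φ) {c : ℝ}
    (hc : c • α ∈ Φ) : c = 1 ∨ c = -1 := by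
  have hα0 : α ≠ 0 := fun h => hΦ.zero_notMem (h ▸ hα)
  have h : c • α ∈ ({α, -α} : Set V) := by
    rw [← hΦ.inter_span α hα]
    exact ⟨hc, Submodule.smul_mem _ _ (Submodule.mem_span_singleton_self α)⟩
  rcases h with h | h
  · left
    exact smul_left_injective ℝ hα0 (by simpa using h)
  · right
    exact smul_left_injective ℝ hα0 (by simpa using h)

section PairOfRoots

variable {α β : V} {t : ℝ}

/-- Here `t` stands for `2 cos (π / m)`. The ratio of lengths appears because the two roots are not
yet known to be equally long. -/
theorem reflection_left_comb (hα : α ≠ 0) (h : inner ℝ α β = -(‖α‖ * ‖β‖ * (t / 2)))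
    (p q : ℝ) :
    (p • α + q • β) - (2 * (inner ℝ α (p • α + q • β) / ‖α‖ ^ 2)) • α =
      (t * (‖β‖ / ‖α‖) * q - p) • α + q • β := by
  have hn : ‖α‖ ≠ 0 := norm_ne_zero_iff.2 hα
  have : 2 * (inner ℝ α (p • α + q • β) / ‖α‖ ^ 2) = 2 * p - t * (‖β‖ / ‖α‖) * q := by
    rw [inner_add_right, real_inner_smul_right, real_inner_smul_right, h,
      real_inner_self_eq_norm_sq]
    field_simp
    ring
  rw [this]
  module

theorem IsRootSystem.left_comb_mem (hΦ : IsRootSystem Φ) (hα : α ∈ Φ)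
    (h : inner ℝ α β = -(‖α‖ * ‖β‖ * (t / 2))) {p q : ℝ} (hpq : p • α + q • β ∈ Φ) :
    (t * (‖β‖ / ‖α‖) * q - p) • α + q • β ∈ Φ := by
  have hα0 : α ≠ 0 := fun h => hΦ.zero_notMem (h ▸ hα)
  rw [← reflection_left_comb hα0 h]
  exact hΦ.reflection_mem hα hpq

theorem IsRootSystem.right_comb_mem (hΦ : IsRootSystem Φ) (hβ : β ∈ Φ)
    (h : inner ℝ α β = -(‖α‖ * ‖β‖ * (t / 2))) {p q : ℝ} (hpq : p • α + q • β ∈ Φ) :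
    p • α + (t * (‖α‖ / ‖β‖) * p - q) • β ∈ Φ := by
  rw [add_comm] at hpq ⊢
  refine hΦ.left_comb_mem hβ ?_ hpq
  rw [real_inner_comm, h, mul_comm ‖α‖]

theorem IsRootSystem.norm_eq_of_smul_mem (hΦ : IsRootSystem Φ) (hα : α ∈ Φ) (hβ : β ∈ Φ)
    (h : (‖β‖ / ‖α‖) • α ∈ Φ) : ‖α‖ = ‖β‖ := by
  have hα0 : 0 < ‖α‖ := norm_pos_iff.2 fun h => hΦ.zero_notMem (h ▸ hα)
  have hβ0 : 0 < ‖β‖ := norm_pos_iff.2 fun h => hΦ.zero_notMem (h ▸ hβ)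
  rcases hΦ.smul_mem_iff hα h with h | h
  · exact ((div_eq_one_iff_eq hα0.ne').1 h).symm
  · have := div_pos hβ0 hα0
    linarith

/-- For an odd bond, alternating reflections carry `β` to a positive multiple of `α` with the length
of `β`. With `k = ‖β‖ / ‖α‖` the orbit is `β, kα + β, kα`. -/
theorem IsRootSystem.norm_eq_of_cos_pi_div_three (hΦ : IsRootSystem Φ) (hα : α ∈ Φ) (hβ : β ∈ Φ)
    (h : inner ℝ α β = -(‖α‖ * ‖β‖ * (1 / 2))) : ‖α‖ = ‖β‖ := by
  have hα0 : ‖α‖ ≠ 0 := norm_ne_zero_iff.2 fun h => hΦ.zero_notMem (h ▸ hα)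
  have hβ0 : ‖β‖ ≠ 0 := norm_ne_zero_iff.2 fun h => hΦ.zero_notMem (h ▸ hβ)
  apply hΦ.norm_eq_of_smul_mem hα hβ
  have h1 := hΦ.left_comb_mem hα h (p := 0) (q := 1) (by simpa)
  have h2 := hΦ.right_comb_mem hβ h h1
  convert h2 using 1
  rw [show 1 * (‖α‖ / ‖β‖) * (1 * (‖β‖ / ‖α‖) * 1 - 0) - 1 = (0 : ℝ) by field_simp; ring]
  simp

/-- With `k = ‖β‖ / ‖α‖`, four alternating reflections give `β, φkα + β, φkα + φβ, kα + φβ, kα`;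
only `φ² = φ + 1` is used. -/
theorem IsRootSystem.norm_eq_of_cos_pi_div_five (hΦ : IsRootSystem Φ) (hα : α ∈ Φ) (hβ : β ∈ Φ)
    (h : inner ℝ α β = -(‖α‖ * ‖β‖ * (Real.goldenRatio / 2))) : ‖α‖ = ‖β‖ := by
  have hα0 : ‖α‖ ≠ 0 := norm_ne_zero_iff.2 fun h => hΦ.zero_notMem (h ▸ hα)
  have hβ0 : ‖β‖ ≠ 0 := norm_ne_zero_iff.2 fun h => hΦ.zero_notMem (h ▸ hβ)
  have hφ := Real.goldenRatio_sq
  generalize Real.goldenRatio = φ at h hφ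
  apply hΦ.norm_eq_of_smul_mem hα hβ
  have h1 := hΦ.left_comb_mem hα h (p := 0) (q := 1) (by simpa)
  have h2 := hΦ.right_comb_mem hβ h h1
  rw [show φ * (‖α‖ / ‖β‖) * (φ * (‖β‖ / ‖α‖) * 1 - 0) - 1 = φ by
    field_simp; linear_combination ‖β‖ * hφ] at h2
  have h3 := hΦ.left_comb_mem hα h h2
  rw [show φ * (‖β‖ / ‖α‖) * φ - (φ * (‖β‖ / ‖α‖) * 1 - 0) = ‖β‖ / ‖α‖ by
    field_simp; linear_combination ‖β‖ * hφ] at h3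
  have h4 := hΦ.right_comb_mem hβ h h3
  rw [show φ * (‖α‖ / ‖β‖) * (‖β‖ / ‖α‖) - φ = 0 by field_simp; ring] at h4
  simpa using h4

end PairOfRoots

variable {Δ : Module.Basis (Fin 4) ℝ V}

theorem cos_pi_div_five_eq : Real.cos (Real.pi / 5) = Real.goldenRatio / 2 := by
  rw [Real.cos_pi_div_five, Real.goldenRatio]
  ring

/-- All simple roots of a root system of type `H₄` have the same length. -/
theorem norm_simple_eq (hΦ : IsRootSystem Φ) (hΔ : ∀ i, Δ i ∈ Φ) (hH4 : IsTypeH4 Δ)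
    (i : Fin 4) : ‖Δ i‖ = ‖Δ 0‖ := by
  have h01 : ‖Δ 0‖ = ‖Δ 1‖ := by
    refine hΦ.norm_eq_of_cos_pi_div_five (hΔ 0) (hΔ 1) ?_
    rw [hH4 0 1, show CoxeterMatrix.H₄ (Fin.rev 0) (Fin.rev 1) = 5 from rfl,
      ← cos_pi_div_five_eq]
    norm_num
  have h12 : ‖Δ 1‖ = ‖Δ 2‖ := by
    refine hΦ.norm_eq_of_cos_pi_div_three (hΔ 1) (hΔ 2) ?_
    rw [hH4 1 2, show CoxeterMatrix.H₄ (Fin.rev 1) (Fin.rev 2) = 3 from rfl,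
      ← Real.cos_pi_div_three]
    norm_num
  have h23 : ‖Δ 2‖ = ‖Δ 3‖ := by
    refine hΦ.norm_eq_of_cos_pi_div_three (hΔ 2) (hΔ 3) ?_
    rw [hH4 2 3, show CoxeterMatrix.H₄ (Fin.rev 2) (Fin.rev 3) = 3 from rfl,
      ← Real.cos_pi_div_three]
    norm_num
  fin_cases i
  · rfl
  · exact h01.symm
  · exact (h01.trans h12).symm
  · exact (h01.trans (h12.trans h23)).symm

/-- The sum of the coordinates at the neighbours of a node in the Coxeter graph, weighted by
`2 cos (π / m)`. -/
def realNeighborSum (c : Fin 4 → ℝ) : Fin 4 → ℝ :=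
  ![Real.goldenRatio * c 1, Real.goldenRatio * c 0 + c 2, c 1 + c 3, c 2]

theorem inner_simple (hΦ : IsRootSystem Φ) (hΔ : ∀ i, Δ i ∈ Φ) (hH4 : IsTypeH4 Δ)
    (i : Fin 4) (β : V) :
    2 * (inner ℝ (Δ i) β / ‖Δ i‖ ^ 2) = 2 * Δ.repr β i - realNeighborSum (Δ.repr β) i := by
  have hn0 : ‖Δ 0‖ ≠ 0 := norm_ne_zero_iff.2 fun h => hΦ.zero_notMem (h ▸ hΔ 0)
  have hn := norm_simple_eq hΦ hΔ hH4
  have hin : ∀ j k, inner ℝ (Δ j) (Δ k) = -(‖Δ 0‖ ^ 2 *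
      Real.cos (Real.pi / (CoxeterMatrix.H₄ (Fin.rev j) (Fin.rev k) : ℝ))) := by
    intro j k
    rw [hH4 j k, hn j, hn k, sq]
  -- The diagonal entries `1` of the Coxeter matrix account for the squared lengths.
  have e1 : Real.cos (Real.pi / (1 : ℕ)) = -1 := by simp
  have e2 : Real.cos (Real.pi / (2 : ℕ)) = 0 := by simp
  have e3 : Real.cos (Real.pi / (3 : ℕ)) = 1 / 2 := by simp
  have e5 : Real.cos (Real.pi / (5 : ℕ)) = Real.goldenRatio / 2 := by
    rw [← cos_pi_div_five_eq]; norm_num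
  rw [hn, inner_eq_sum_repr Δ, Fin.sum_univ_four, hin, hin, hin, hin]
  fin_cases i
  · change 2 * ((_ * -(_ * Real.cos (Real.pi / (1 : ℕ))) +
      _ * -(_ * Real.cos (Real.pi / (5 : ℕ))) + _ * -(_ * Real.cos (Real.pi / (2 : ℕ))) +
      _ * -(_ * Real.cos (Real.pi / (2 : ℕ)))) / _) =
      2 * Δ.repr β 0 - Real.goldenRatio * Δ.repr β 1
    rw [e1, e2, e5]
    field_simp
    ring
  · change 2 * ((_ * -(_ * Real.cos (Real.pi / (5 : ℕ))) +
      _ * -(_ * Real.cos (Real.pi / (1 : ℕ))) + _ * -(_ * Real.cos (Real.pi / (3 : ℕ))) +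
      _ * -(_ * Real.cos (Real.pi / (2 : ℕ)))) / _) =
      2 * Δ.repr β 1 - (Real.goldenRatio * Δ.repr β 0 + Δ.repr β 2)
    rw [e1, e2, e3, e5]
    field_simp
    ring
  · change 2 * ((_ * -(_ * Real.cos (Real.pi / (2 : ℕ))) +
      _ * -(_ * Real.cos (Real.pi / (3 : ℕ))) + _ * -(_ * Real.cos (Real.pi / (1 : ℕ))) +
      _ * -(_ * Real.cos (Real.pi / (3 : ℕ)))) / _) =
      2 * Δ.repr β 2 - (Δ.repr β 1 + Δ.repr β 3)
    rw [e1, e2, e3]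
    field_simp
    ring
  · change 2 * ((_ * -(_ * Real.cos (Real.pi / (2 : ℕ))) +
      _ * -(_ * Real.cos (Real.pi / (2 : ℕ))) + _ * -(_ * Real.cos (Real.pi / (3 : ℕ))) +
      _ * -(_ * Real.cos (Real.pi / (1 : ℕ)))) / _) =
      2 * Δ.repr β 3 - Δ.repr β 2
    rw [e1, e2, e3]
    field_simp
    ring

/-- The simple reflections preserve the root system. -/
theorem simple_reflection_mem (hΦ : IsRootSystem Φ) (hΔ : ∀ i, Δ i ∈ Φ) (hH4 : IsTypeH4 Δ)
    (i : Fin 4) {β : V} (hβ : β ∈ Φ) :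
    β - (2 * Δ.repr β i - realNeighborSum (Δ.repr β) i) • Δ i ∈ Φ := by
  rw [← inner_simple hΦ hΔ hH4]
  exact hΦ.reflection_mem (hΔ i) hβ

theorem realNeighborSum_congr {c d : Fin 4 → ℝ} {i : Fin 4} (h : ∀ j, i ≠ j → c j = d j) :
    realNeighborSum c i = realNeighborSum d i := by
  fin_cases i
  · simp [realNeighborSum, h 1]
  · simp [realNeighborSum, h 0, h 2]
  · simp [realNeighborSum, h 1, h 3]
  · simp [realNeighborSum, h 2]

/-- Some simple reflection lowers a given nonzero vector with nonnegative coordinates. -/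
theorem exists_descent (hΦ : IsRootSystem Φ) (hΔ : ∀ i, Δ i ∈ Φ) (hH4 : IsTypeH4 Δ)
    {β : V} (hβ0 : β ≠ 0) (hβ : ∀ i, 0 ≤ Δ.repr β i) :
    ∃ i, 0 < Δ.repr β i ∧ 0 < 2 * Δ.repr β i - realNeighborSum (Δ.repr β) i := by
  by_contra! hle
  -- Since `(β|β) = ∑ βᵢ (β|αᵢ)` is positive, some term with `βᵢ > 0` must have `(β|αᵢ) > 0`.
  have h1 : 0 < inner ℝ β β := real_inner_self_pos.2 hβ0
  rw [inner_eq_sum_repr Δ] at h1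
  refine h1.not_ge (Finset.sum_nonpos fun i _ => ?_)
  rcases (hβ i).eq_or_lt with h | h
  · rw [← h, zero_mul]
  · have hpos : 0 < ‖Δ i‖ := norm_pos_iff.2 fun h => hΦ.zero_notMem (h ▸ hΔ i)
    have h2 := hle i h
    rw [← inner_simple hΦ hΔ hH4] at h2
    apply mul_nonpos_of_nonneg_of_nonpos h.le
    rw [real_inner_comm]
    by_contra! h3
    have : 0 < inner ℝ (Δ i) β / ‖Δ i‖ ^ 2 := by positivity
    linarith

/-- The vector with the given coordinates. -/
def rootVec (Δ : Module.Basis (Fin 4) ℝ V) (r : GoldenVec) : V :=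
  ∑ i, GoldenNat.toReal (r i) • Δ i

@[simp]
theorem repr_rootVec (r : GoldenVec) (i : Fin 4) :
    Δ.repr (rootVec Δ r) i = GoldenNat.toReal (r i) := by
  rw [rootVec, Module.Basis.repr_sum_self]

theorem inner_rootVec (v : V) (r : GoldenVec) :
    inner ℝ v (rootVec Δ r) = ∑ i, GoldenNat.toReal (r i) * inner ℝ v (Δ i) := by
  rw [inner_eq_sum_repr Δ]
  simp

theorem GoldenVec.le_iff (r s : GoldenVec) :
    r.le s = true ↔ ∀ i, GoldenNat.toReal (r i) ≤ GoldenNat.toReal (s i) := by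
  simp [GoldenVec.le, GoldenNat.le_iff, Fin.forall_fin_succ, and_assoc]

theorem rootLE_rootVec_iff (r s : GoldenVec) :
    rootLE Δ (rootVec Δ r) (rootVec Δ s) ↔ r.le s = true := by
  simp [rootLE, GoldenVec.le_iff]

theorem rootVec_simpleVec (i : Fin 4) : rootVec Δ (simpleVec i) = Δ i := by
  simp [rootVec, simpleVec, Pi.single_apply, apply_ite GoldenNat.toReal]

theorem rootVec_injective : Function.Injective (rootVec Δ) := by
  intro r s h
  ext1 i
  have h1 : GoldenNat.toReal (r i) = GoldenNat.toReal (s i) := by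
    rw [← repr_rootVec (Δ := Δ), h, repr_rootVec]
  exact GoldenNat.toReal_injective h1

theorem toReal_neighborSum (r : GoldenVec) (i : Fin 4) :
    GoldenNat.toReal (neighborSum r i) =
      realNeighborSum (fun j => GoldenNat.toReal (r j)) i := by
  have hτ : GoldenNat.toReal ⟨0, 1⟩ = Real.goldenRatio := by simp [GoldenNat.toReal_apply]
  fin_cases i <;> simp [neighborSum, realNeighborSum, hτ]

/-- `isReflection` is phrased as a sum because `ℕ[τ]` has no subtraction; over `ℝ` it becomes the
usual formula for a simple reflection. -/
theorem rootVec_of_isReflection {i : Fin 4} {r s : GoldenVec} (h : isReflection i r s = true) :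
    rootVec Δ s = rootVec Δ r -
      (2 * Δ.repr (rootVec Δ r) i - realNeighborSum (Δ.repr (rootVec Δ r)) i) • Δ i := by
  simp only [isReflection, Bool.and_eq_true, decide_eq_true_eq] at h
  obtain ⟨h1, h2⟩ := h
  have h3 := congrArg GoldenNat.toReal h1
  rw [map_add, toReal_neighborSum] at h3
  have h4 : (⇑(Δ.repr (rootVec Δ r)) : Fin 4 → ℝ) = fun j => GoldenNat.toReal (r j) :=
    funext fun j => repr_rootVec r j
  apply Δ.ext_elem
  intro j
  rw [map_sub, map_smul, Finsupp.sub_apply, Finsupp.smul_apply, repr_rootVec, h4, Δ.repr_self,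
    Finsupp.single_apply, ← h3]
  split_ifs with hij
  · subst hij
    simp
    ring
  · rcases h2 j with h | h
    · exact absurd h.symm hij
    · simp [h]

/-- The neighbour sum at `i` does not involve the coordinate `i`, the only one that may change. -/
theorem isReflection_symm {i : Fin 4} {r s : GoldenVec} (h : isReflection i r s = true) :
    isReflection i s r = true := by
  simp only [isReflection, Bool.and_eq_true, decide_eq_true_eq] at h ⊢
  obtain ⟨h1, h2⟩ := h
  refine ⟨?_, fun j => (h2 j).imp_right Eq.symm⟩
  rw [add_comm, h1]
  have h3 : ∀ j, j ≠ i → r j = s j := fun j hj => (h2 j).resolve_left hj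
  fin_cases i
  · simp [neighborSum, h3 1]
  · simp [neighborSum, h3 0, h3 2]
  · simp [neighborSum, h3 1, h3 3]
  · simp [neighborSum, h3 2]

/-- Take an entry outside `Φ` with least coordinate sum. A descending simple reflection leads to a
lower entry, which lies in `Φ`; reflecting back gives a contradiction. -/
theorem rootVec_mem (hΦ : IsRootSystem Φ) (hΔ : ∀ i, Δ i ∈ Φ) (hH4 : IsTypeH4 Δ) :
    ∀ r ∈ rootTable, rootVec Δ r ∈ Φ := by
  by_contra! hbad
  have hfin : {r | r ∈ rootTable ∧ rootVec Δ r ∉ Φ}.Finite :=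
    rootTable.toFinset.finite_toSet.subset fun r hr => by simpa using hr.1
  obtain ⟨r, ⟨hr, hrΦ⟩, hmin⟩ := Set.exists_min_image _
    (fun r => ∑ i, Δ.repr (rootVec Δ r) i) hfin hbad
  have hr0 : rootVec Δ r ≠ 0 := by
    intro h
    apply rootTable_ne_zero r hr
    apply rootVec_injective (Δ := Δ)
    rw [h]
    simp [rootVec]
  obtain ⟨i, -, hi⟩ := exists_descent hΦ hΔ hH4 hr0 fun i => by
    rw [repr_rootVec]; exact GoldenNat.toReal_nonneg _
  rcases rootTable_reflection r hr i with rfl | ⟨s, hs, hrs⟩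
  · exact hrΦ (by rw [rootVec_simpleVec]; exact hΔ i)
  · have hsΦ : rootVec Δ s ∈ Φ := by
      by_contra hsΦ
      have := hmin s ⟨hs, hsΦ⟩
      rw [rootVec_of_isReflection hrs] at this
      simp only [map_sub, map_smul, Finsupp.sub_apply, Finsupp.smul_apply, Δ.repr_self,
        Finset.sum_sub_distrib, smul_eq_mul, ← Finset.mul_sum] at this
      simp only [Finsupp.single_apply, Finset.sum_ite_eq, Finset.mem_univ, if_true] at this
      linarith
    have := simple_reflection_mem hΦ hΔ hH4 i hsΦ
    rw [← rootVec_of_isReflection (isReflection_symm hrs)] at this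
    exact hrΦ this

/-- The table lists all positive roots. -/
theorem posRoots_eq (hΦ : IsRootSystem Φ) (hΔ : IsSimpleSystem Φ Δ) (hH4 : IsTypeH4 Δ) :
    posRoots Φ Δ = rootVec Δ '' {r | r ∈ rootTable} := by
  apply Set.Subset.antisymm
  · by_contra hbad
    rw [Set.not_subset] at hbad
    -- A missing positive root `β` of least coordinate sum; its descending reflection is `β - c • Δ
    -- i` with `c > 0`.
    obtain ⟨β, ⟨hβ, hβt⟩, hmin⟩ := Set.exists_min_image
      {β | β ∈ posRoots Φ Δ ∧ β ∉ rootVec Δ '' {r | r ∈ rootTable}}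
      (fun β => ∑ i, Δ.repr β i) (hΦ.finite.subset fun β hβ => hβ.1.1) hbad
    have hβ0 : β ≠ 0 := fun h => hΦ.zero_notMem (h ▸ hβ.1)
    obtain ⟨i, hi0, hi⟩ := exists_descent hΦ hΔ.mem hH4 hβ0 hβ.2
    have hγΦ := simple_reflection_mem hΦ hΔ.mem hH4 i hβ.1
    set c := 2 * Δ.repr β i - realNeighborSum (Δ.repr β) i with hc
    have hrepr : ∀ j, Δ.repr (β - c • Δ i) j = Δ.repr β j - if i = j then c else 0 := by
      intro j
      simp [Finsupp.single_apply]
    rcases hΔ.sameSign _ hγΦ with hpos | hneg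
    · have hγt : β - c • Δ i ∈ rootVec Δ '' {r | r ∈ rootTable} := by
        by_contra hγt
        have := hmin _ ⟨⟨hγΦ, hpos⟩, hγt⟩
        simp only [hrepr, Finset.sum_sub_distrib, Finset.sum_ite_eq, Finset.mem_univ,
          if_true] at this
        linarith
      obtain ⟨r, hr, hrγ⟩ := hγt
      rcases rootTable_reflection r hr i with rfl | ⟨s, hs, hrs⟩
      -- If the reflected root is `Δ i` itself, `β` is a multiple of `Δ i` by a factor above 1,
      -- which is impossible.
      · have hβi : β = (1 + c) • Δ i := by
          rw [rootVec_simpleVec] at hrγ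
          rw [add_smul, one_smul, add_comm]
          exact sub_eq_iff_eq_add'.1 hrγ.symm
        have hmem := hβ.1
        rw [hβi] at hmem
        rcases hΦ.smul_mem_iff (hΔ.mem i) hmem with h | h <;> linarith
      · apply hβt
        refine ⟨s, hs, ?_⟩
        rw [rootVec_of_isReflection hrs, hrγ, hrepr,
          realNeighborSum_congr (d := Δ.repr β) fun j hj => by rw [hrepr, if_neg hj, sub_zero],
          if_pos rfl, show 2 * (Δ.repr β i - c) - realNeighborSum (Δ.repr β) i = -c by
            rw [hc]; ring]
        module
    -- Only coordinate `i` changes, so the others are both nonnegative and nonpositive, and `β` is a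
    -- multiple of `Δ i`.
    · have hβi : β = Δ.repr β i • Δ i := by
        apply Δ.ext_elem
        intro j
        have h1 := hneg j
        have h2 := hβ.2 j
        rw [hrepr] at h1
        rw [map_smul, Δ.repr_self, Finsupp.smul_apply, Finsupp.single_apply]
        split_ifs at h1 ⊢ with hij
        · simp [hij]
        · simp only [smul_zero]
          linarith
      have hmem := hβ.1
      rw [hβi] at hmem
      rcases hΦ.smul_mem_iff (hΔ.mem i) hmem with h | h
      · apply hβt
        refine ⟨simpleVec i, simpleVec_mem_rootTable i, ?_⟩
        rw [rootVec_simpleVec, hβi, h, one_smul]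
      · linarith
  · rintro _ ⟨r, hr, rfl⟩
    exact ⟨rootVec_mem hΦ hΔ.mem hH4 r hr, fun i => by
      rw [repr_rootVec]; exact GoldenNat.toReal_nonneg _⟩

end RootSystems

variable {V : Type*} [NormedAddCommGroup V] [InnerProductSpace ℝ V] {Φ : Set V}
  {Δ : Module.Basis (Fin 4) ℝ V}

/-! ### Encoding sets of positive roots. -/

section SetMask

open Classical in
/-- The bitmask of a set of positive roots. -/
def setMask (Δ : Module.Basis (Fin 4) ℝ V) (I : Set V) : ℕ :=
  bitmask (fun r => decide (rootVec Δ r ∈ I)) rootTable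

theorem setMask_eq_bitmask {I : Set V} {p : GoldenVec → Bool}
    (h : ∀ r ∈ rootTable, rootVec Δ r ∈ I ↔ p r = true) : setMask Δ I = bitmask p rootTable := by
  classical
  rw [setMask, bitmask_eq_iff]
  intro r hr
  rw [Bool.eq_iff_iff, ← h r hr, decide_eq_true_iff]

variable (hP : posRoots Φ Δ = rootVec Δ '' {r | r ∈ rootTable})
include hP

theorem rootVec_mem_posRoots {r : GoldenVec} (hr : r ∈ rootTable) : rootVec Δ r ∈ posRoots Φ Δ :=
  hP ▸ Set.mem_image_of_mem _ hr

theorem injOn_setMask : Set.InjOn (setMask Δ) {I | I ⊆ posRoots Φ Δ} := by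
  classical
  intro I hI J hJ h
  rw [setMask, setMask, bitmask_eq_iff] at h
  ext β
  by_cases hβ : β ∈ posRoots Φ Δ
  · obtain ⟨r, hr, rfl⟩ := hP ▸ hβ
    simpa using h r hr
  · exact iff_of_false (fun h => hβ (hI h)) (fun h => hβ (hJ h))

theorem setMask_mem_upMasks {I : Set V} (hI : I ∈ increasingSets Φ Δ) :
    setMask Δ I ∈ upMasks GoldenVec.le rootTable := by
  classical
  apply bitmask_mem_upMasks
  rw [List.pairwise_iff_forall_sublist]
  intro r s hrs hle hr
  rw [decide_eq_true_iff] at hr ⊢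
  have hmem := fun t ht => rootVec_mem_posRoots hP (hrs.subset (a := t) ht)
  exact hI.2 _ (hmem r (by simp)) _ (hmem s (by simp)) ((rootLE_rootVec_iff r s).2 hle) hr

theorem ncard_posRoots : (posRoots Φ Δ).ncard = 60 := by
  classical
  have hnodup : rootTable.Nodup := rootTable_pairwise.imp fun {r s} h hrs => by
    subst hrs
    rw [(GoldenVec.le_iff r r).2 fun _ => le_rfl] at h
    exact Bool.noConfusion h
  rw [hP, Set.ncard_image_of_injective _ rootVec_injective,
    show {r | r ∈ rootTable} = (rootTable.toFinset : Set GoldenVec) by ext; simp,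
    Set.ncard_coe_finset, List.toFinset_card_of_nodup hnodup]
  rfl

end SetMask

/-! ### The exceptional antichains in terms of the table. -/

section Exceptional

theorem h4Root_eq (Δ : Module.Basis (Fin 4) ℝ V) :
    ∀ k ∈ [13, 14, 16, 17, 18, 19, 20, 21, 22, 23, 25, 28],
      h4Root Δ k = rootVec Δ (tableRoot k) := by
  have h : ∀ (k : ℕ) (c : Fin 4 → ℝ), h4Coords k = c →
      (∀ i, c i = GoldenNat.toReal (tableRoot k i)) → h4Root Δ k = rootVec Δ (tableRoot k) := by
    intro k c hc h
    rw [h4Root, rootVec, hc]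
    exact Finset.sum_congr rfl fun i _ => by rw [h i]
  have hτ : h4Coords.τ = Real.goldenRatio := rfl
  intro k hk
  fin_cases hk
  all_goals
    refine h _ _ rfl fun i => ?_
    fin_cases i <;>
    simp [h4Coords, hτ, tableRoot, rootTable, GoldenNat.toReal_apply, add_comm]

theorem exceptionalAntichain_eq (Δ : Module.Basis (Fin 4) ℝ V) (i : Fin 16) :
    exceptionalAntichain Δ i = {β | ∃ k ∈ exceptionalList i, rootVec Δ (tableRoot k) = β} := by
  have h1 : exceptionalIndices i = {k | k ∈ exceptionalList i} := by
    fin_cases i <;> ext k <;> simp [exceptionalIndices, exceptionalList]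
  have h2 : ∀ i, ∀ k ∈ exceptionalList i,
      k ∈ [13, 14, 16, 17, 18, 19, 20, 21, 22, 23, 25, 28] := by decide +kernel
  rw [exceptionalAntichain, h1]
  ext β
  refine exists_congr fun k => and_congr_right fun hk => ?_
  rw [h4Root_eq Δ k (h2 i k hk)]

variable (hP : posRoots Φ Δ = rootVec Δ '' {r | r ∈ rootTable})
include hP

theorem exceptionalAntichain_mem (i : Fin 16) :
    exceptionalAntichain Δ i ∈ antichains Φ Δ := by
  rw [exceptionalAntichain_eq]
  constructor
  · rintro _ ⟨k, hk, rfl⟩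
    exact rootVec_mem_posRoots hP (exceptionalList_antichain i k hk).1
  · rintro _ ⟨k, hk, rfl⟩ _ ⟨l, hl, rfl⟩ hne hle
    rw [rootLE_rootVec_iff] at hle
    exact hne (by rw [(exceptionalList_antichain i k hk).2 l hl hle])

theorem rootVec_mem_generatedSet {r : GoldenVec} (hr : r ∈ rootTable) (i : Fin 16) :
    rootVec Δ r ∈ generatedSet Φ Δ (exceptionalAntichain Δ i) ↔
      generatedTest (exceptionalList i) r = true := by
  simp [generatedSet, exceptionalAntichain_eq, rootVec_mem_posRoots hP hr, generatedTest,
    rootLE_rootVec_iff]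

theorem setMask_generatedSet (i : Fin 16) :
    setMask Δ (generatedSet Φ Δ (exceptionalAntichain Δ i)) =
      bitmask (generatedTest (exceptionalList i)) rootTable :=
  setMask_eq_bitmask fun _ hr => rootVec_mem_generatedSet hP hr i

theorem mem_exceptionalMasks {m : ℕ} :
    m ∈ exceptionalMasks ↔
      ∃ i, setMask Δ (generatedSet Φ Δ (exceptionalAntichain Δ i)) = m := by
  simp only [setMask_generatedSet hP]
  rw [exceptionalMasks, List.map_ofFn, List.mem_ofFn]
  rfl

theorem injective_generatedSet_exceptional :
    Function.Injective fun i => generatedSet Φ Δ (exceptionalAntichain Δ i) := by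
  intro i j hij
  have h := congrArg (setMask Δ) hij
  simp only [setMask_generatedSet hP] at h
  have hn := nodup_exceptionalMasks
  rw [exceptionalMasks, List.map_ofFn, List.nodup_ofFn] at hn
  exact hn h

end Exceptional

/-! ### Exceptional sets do not come from regions. -/

section Infeasible

theorem rootVec_combination (l : List (GoldenNat × ℕ)) :
    rootVec Δ (combination l) =
      (l.map fun p => GoldenNat.toReal p.1 • rootVec Δ (tableRoot p.2)).sum := by
  induction l with
  | nil => simp [combination, rootVec]
  | cons p l ih =>
    rw [List.map_cons, List.sum_cons, ← ih]
    simp [combination, rootVec, add_smul, Finset.sum_add_distrib, Finset.smul_sum, mul_smul]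

theorem inner_rootVec_combination (v : V) (l : List (GoldenNat × ℕ)) :
    inner ℝ v (rootVec Δ (combination l)) =
      (l.map fun p => GoldenNat.toReal p.1 * inner ℝ v (rootVec Δ (tableRoot p.2))).sum := by
  rw [rootVec_combination]
  induction l with
  | nil => simp
  | cons p l ih => simp [inner_add_right, inner_smul_right, ih]

theorem toReal_totalWeight (l : List (GoldenNat × ℕ)) :
    GoldenNat.toReal (totalWeight l) = (l.map fun p => GoldenNat.toReal p.1).sum := by
  rw [totalWeight, map_list_sum, List.map_map]
  rfl

/-- The first combination exceeds its total weight at `v`, strictly because it is nonempty with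
positive weights. The second is at most its own total weight. On the chamber the first is at most
the second, contradicting the comparison of weights. -/
theorem setOf_one_lt_inner_ne (hP : posRoots Φ Δ = rootVec Δ '' {r | r ∈ rootTable}) {v : V}
    (hv : v ∈ dominantChamber Δ) (i : Fin 16) :
    {β ∈ posRoots Φ Δ | 1 < inner ℝ v β} ≠ generatedSet Φ Δ (exceptionalAntichain Δ i) := by
  intro h
  have key : ∀ r ∈ rootTable,
      (1 < inner ℝ v (rootVec Δ r) ↔ generatedTest (exceptionalList i) r = true) := by
    intro r hr
    rw [← rootVec_mem_generatedSet hP hr, ← h]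
    simp [rootVec_mem_posRoots hP hr]
  have h1 : GoldenNat.toReal (totalWeight (certificate i).1) <
      inner ℝ v (rootVec Δ (combination (certificate i).1)) := by
    rw [inner_rootVec_combination, toReal_totalWeight]
    refine List.sum_lt_sum_of_ne_nil (certificate_fst i).1 _ _ fun p hp => ?_
    obtain ⟨hp0, hpt, hpg⟩ := (certificate_fst i).2 p hp
    have hpos : 0 < GoldenNat.toReal p.1 := by
      refine lt_of_le_of_ne (GoldenNat.toReal_nonneg _) fun h => hp0 ?_
      exact GoldenNat.toReal_injective (by rw [← h, map_zero])
    exact lt_mul_of_one_lt_right hpos ((key _ hpt).2 hpg)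
  have h2 : inner ℝ v (rootVec Δ (combination (certificate i).2)) ≤
      GoldenNat.toReal (totalWeight (certificate i).2) := by
    rw [inner_rootVec_combination, toReal_totalWeight]
    refine List.sum_le_sum fun p hp => ?_
    obtain ⟨hpt, hpg⟩ := certificate_snd i p hp
    refine mul_le_of_le_one_right (GoldenNat.toReal_nonneg _) (not_lt.1 fun h => ?_)
    rw [(key _ hpt).1 h] at hpg
    exact Bool.noConfusion hpg
  obtain ⟨h3, h4⟩ := certificate_le i
  rw [GoldenNat.le_iff] at h4
  have h5 := inner_le_of_rootLE hv ((rootLE_rootVec_iff (Δ := Δ) _ _).2 h3)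
  linarith

end Infeasible

/-! ### Sample points realise all other increasing sets. -/

section Samples

theorem inner_rootVec_eq_sampleValue {v : V} {n : ℕ}
    (hv : ∀ i : Fin 4, inner ℝ v (Δ i) = 2 / 123 * (digit n i : ℝ)) (r : GoldenVec) :
    inner ℝ v (rootVec Δ r) = 2 / 123 * GoldenNat.toReal (sampleValue n r) := by
  simp only [inner_rootVec, hv, GoldenNat.toReal_apply, sampleValue, Fin.sum_univ_four]
  push_cast
  simp only [Fin.val_zero, Fin.val_one, Fin.val_two, show ((3 : Fin 4) : ℕ) = 3 from rfl]
  ring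

/-- This explains the unit `2 / 123`: the value 1 would require `a + bτ = 123 / 2` with `a`, `b`
natural numbers, hence `2a = 123` by irrationality of `τ`, which parity forbids. -/
theorem inner_rootVec_ne_one {v : V} {n : ℕ}
    (hv : ∀ i : Fin 4, inner ℝ v (Δ i) = 2 / 123 * (digit n i : ℝ)) (r : GoldenVec) :
    inner ℝ v (rootVec Δ r) ≠ 1 := by
  rw [inner_rootVec_eq_sampleValue hv, GoldenNat.toReal_apply]
  intro h
  obtain ⟨h1, -⟩ := GoldenNat.eq_of_mul_goldenRatio_eq (a := (sampleValue n r).re)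
    (b := (sampleValue n r).im) (c := 123 / 2) (d := 0) (by push_cast; linarith)
  have h2 : 2 * (sampleValue n r).re = 123 := by
    have : (2 * (sampleValue n r).re : ℚ) = 123 := by rw [h1]; norm_num
    exact_mod_cast this
  omega

theorem sampleTest_iff {v : V} {n : ℕ}
    (hv : ∀ i : Fin 4, inner ℝ v (Δ i) = 2 / 123 * (digit n i : ℝ)) (r : GoldenVec) :
    1 < inner ℝ v (rootVec Δ r) ↔ sampleTest n r = true := by
  rw [inner_rootVec_eq_sampleValue hv, sampleTest, Bool.not_eq_true', ← Bool.not_eq_true,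
    GoldenNat.le_iff, not_le]
  simp only [GoldenNat.toReal_apply]
  push_cast
  constructor <;> intro _ <;> linarith

variable (hP : posRoots Φ Δ = rootVec Δ '' {r | r ∈ rootTable})
include hP

theorem exists_setMask_eq {n : ℕ} (hn : n ∈ samplePoints) :
    ∃ v ∈ dominantChamber Δ, (∀ β ∈ posRoots Φ Δ, inner ℝ v β ≠ 1) ∧
      setMask Δ {β ∈ posRoots Φ Δ | 1 < inner ℝ v β} = bitmask (sampleTest n) rootTable := by
  obtain ⟨v, hv⟩ := exists_inner_eq Δ fun i => 2 / 123 * (digit n i : ℝ)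
  refine ⟨v, fun i => ?_, ?_, ?_⟩
  · rw [hv]
    have : (0 : ℝ) < digit n i := by exact_mod_cast samplePoints_pos n hn i
    positivity
  · rw [hP]
    rintro _ ⟨r, -, rfl⟩
    exact inner_rootVec_ne_one hv r
  · refine setMask_eq_bitmask fun r hr => ?_
    rw [← sampleTest_iff hv]
    simp [rootVec_mem_posRoots hP hr]

end Samples

/-! ### The image of the region map and the final counts. -/

/-- The image of the dominant regions consists of the non-exceptional increasing sets; there are
`413` of them. -/
theorem image_regionRoots_eq (h0 : (0 : V) ∉ Φ) (hΔ : ∀ i, Δ i ∈ Φ)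
    (hP : posRoots Φ Δ = rootVec Δ '' {r | r ∈ rootTable}) :
    regionRoots Φ Δ '' dominantRegions Φ Δ =
        increasingSets Φ Δ \ Set.range (fun i => generatedSet Φ Δ (exceptionalAntichain Δ i)) ∧
      (regionRoots Φ Δ '' dominantRegions Φ Δ).ncard = 413 := by
  set masks : List ℕ := samplePoints.map fun n => bitmask (sampleTest n) rootTable with hmasks
  have hinj := injOn_setMask hP
  have hsub : ∀ I ∈ increasingSets Φ Δ, I ∈ {I | I ⊆ posRoots Φ Δ} := fun I hI => hI.1
  have himage : ∀ I ∈ regionRoots Φ Δ '' dominantRegions Φ Δ, I ∈ increasingSets Φ Δ \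
      Set.range (fun i => generatedSet Φ Δ (exceptionalAntichain Δ i)) := by
    intro I hI
    refine ⟨(mapsTo_regionRoots h0 hΔ).image_subset hI, ?_⟩
    rw [image_regionRoots h0 hΔ] at hI
    obtain ⟨v, hv, -, rfl⟩ := hI
    rintro ⟨i, hi⟩
    exact setOf_one_lt_inner_ne hP hv i hi.symm
  have hmem : ∀ I ∈ increasingSets Φ Δ \
      Set.range (fun i => generatedSet Φ Δ (exceptionalAntichain Δ i)),
      setMask Δ I ∈ masks := by
    rintro I ⟨hI, hI'⟩
    rw [hmasks, ← filter_upMasks, List.mem_filter]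
    refine ⟨setMask_mem_upMasks hP hI, ?_⟩
    rw [Bool.not_eq_true', ← Bool.not_eq_true, List.contains_iff_mem, mem_exceptionalMasks hP]
    rintro ⟨i, hi⟩
    exact hI' ⟨i, hinj (hsub _ (generatedSet_mem_increasingSets _)) (hsub I hI) hi⟩
  have hexists : ∀ m ∈ masks, ∃ I ∈ regionRoots Φ Δ '' dominantRegions Φ Δ,
      setMask Δ I = m := by
    intro m hm
    obtain ⟨n, hn, rfl⟩ := List.mem_map.1 hm
    obtain ⟨v, hv, hv1, hmask⟩ := exists_setMask_eq hP hn
    refine ⟨_, ?_, hmask⟩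
    rw [image_regionRoots h0 hΔ]
    exact ⟨v, hv, hv1, rfl⟩
  constructor
  -- A non-exceptional increasing set has the mask of some sample point, hence the mask of a set
  -- coming from a region, and masks determine sets.
  · refine Set.Subset.antisymm himage fun I hI => ?_
    obtain ⟨J, hJ, hJI⟩ := hexists _ (hmem I hI)
    rwa [← hinj (hsub J (himage J hJ).1) (hsub I hI.1) hJI]
  · have himg : setMask Δ '' (regionRoots Φ Δ '' dominantRegions Φ Δ) = masks.toFinset := by
      ext m
      rw [Finset.mem_coe, List.mem_toFinset]
      constructor
      · rintro ⟨I, hI, rfl⟩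
        exact hmem I (himage I hI)
      · exact hexists m
    -- The sample masks are distinct because they form a sublist of the duplicate-free enumeration
    -- of increasing sets.
    have hnodup : masks.Nodup := by
      rw [hmasks, ← filter_upMasks]
      exact (nodup_upMasks _ _).filter _
    rw [← (hinj.mono fun I hI => hsub I (himage I hI).1).ncard_image, himg, Set.ncard_coe_finset,
      List.toFinset_card_of_nodup hnodup, hmasks, List.length_map, length_samplePoints]

end RootRegions

end

open RootRegions in
theorem theorem4p3 {V : Type*} [NormedAddCommGroup V] [InnerProductSpace ℝ V]
    (Φ : Set V) (Δ : Module.Basis (Fin 4) ℝ V)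
    (hΦ : IsRootSystem Φ) (hΔ : IsSimpleSystem Φ Δ) (hH4 : IsTypeH4 Δ) :
    -- there are 60 positive roots and 429 antichains
    (posRoots Φ Δ).ncard = 60 ∧
    (antichains Φ Δ).ncard = 429 ∧
    -- the sixteen exceptional sets are distinct antichains of positive roots
    (∀ i, exceptionalAntichain Δ i ∈ antichains Φ Δ) ∧
    Function.Injective (exceptionalAntichain Δ) ∧
    -- `R ↦ I_R` is an injective map from dominant regions to increasing sets, with the stated image
    Set.MapsTo (regionRoots Φ Δ) (dominantRegions Φ Δ) (increasingSets Φ Δ) ∧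
    Set.InjOn (regionRoots Φ Δ) (dominantRegions Φ Δ) ∧
    ¬ Set.SurjOn (regionRoots Φ Δ) (dominantRegions Φ Δ) (increasingSets Φ Δ) ∧
    regionRoots Φ Δ '' dominantRegions Φ Δ =
      increasingSets Φ Δ \ Set.range (fun i => generatedSet Φ Δ (exceptionalAntichain Δ i)) ∧
    -- there are exactly 413 dominant regions
    (dominantRegions Φ Δ).ncard = 413 := by
  have hP := posRoots_eq hΦ hΔ hH4
  have h0 := hΦ.zero_notMem
  obtain ⟨himage, hcard⟩ := image_regionRoots_eq h0 hΔ.mem hP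
  have hinj := injective_generatedSet_exceptional hP
  have hrange : Set.range (fun i => generatedSet Φ Δ (exceptionalAntichain Δ i)) ⊆
      increasingSets Φ Δ := by
    rintro _ ⟨i, rfl⟩
    exact generatedSet_mem_increasingSets _
  -- The count is `413 + 16`: sets coming from regions plus the distinct exceptional ones.
  have hincr : (increasingSets Φ Δ).ncard = 429 := by
    have hfin : (increasingSets Φ Δ).Finite :=
      hΦ.finite.finite_subsets.subset fun I hI => hI.1.trans fun β hβ => hβ.1
    rw [← Set.ncard_sdiff_add_ncard_of_subset hrange hfin, ← himage, hcard,
      Set.ncard_range_of_injective hinj]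
    simp
  refine ⟨ncard_posRoots hP, (ncard_antichains hΦ.finite).trans hincr,
    exceptionalAntichain_mem hP, fun i j hij => hinj (congrArg (generatedSet Φ Δ) hij),
    mapsTo_regionRoots h0 hΔ.mem, injOn_regionRoots h0 hΔ.mem, fun hsurj => ?_, himage, ?_⟩
  · have h := hsurj (hrange ⟨0, rfl⟩)
    rw [himage] at h
    exact h.2 ⟨0, rfl⟩
  · rw [← (injOn_regionRoots h0 hΔ.mem).ncard_image, hcard]
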